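/- Let $r,n\ge 1$, $\zeta=e^{2\pi i/r}$, and let $W=G(r,1,n)$ be the group of $n\times n$ monomial matrices whose non-zero entries are $r$-th roots of $1$; let $\zeta_i=\mathrm{diag}(1,\dots,\zeta,\dots,1)$ (with $\zeta$ in position $i$), $s_{ij}$ the transposition matrices and $s_i=s_{i,i+1}$. Let $F=\mathbb{C}(\kappa,c_0,d_1,\dots,d_{r-1})$ be the field of rational functions in the parameters, with $d_0=-(d_1+\dots+d_{r-1})$ and $d_i=d_j$ for $i\equiv j \bmod r$. Let $y_1,\dots,y_n$ be the standard basis of $\mathbb{C}^n$ and $x_1,\dots,x_n$ the dual basis. The rational Cherednik algebra $\mathbb{H}$ is the $F$-algebra generated by $F[x_1,\dots,x_n]$, $F[y_1,\dots,y_n]$ and the group algebra $FW$ (with basis $t_w$, $w\in W$), with relations $t_wx=(wx)t_w$, $t_wy=(wy)t_w$, $$y_ix_j=x_jy_i+c_0\sum_{l=0}^{r-1}\zeta^{-l}t_{\zeta_i^ls_{ij}\zeta_i^{-l}}\quad(i\ne j),$$ $$y_ix_i=x_iy_i+\kappa-\sum_{j=0}^{r-1}(d_j-d_{j-1})e_{ij}-c_0\sum_{j\ne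 i}\sum_{l=0}^{r-1}t_{\zeta_i^ls_{ij}\zeta_i^{-l}},\qquad e_{ij}=\frac1r\sum_{l=0}^{r-1}\zeta^{-lj}t_{\zeta_i^l}.$$ Put $\phi_i=\sum_{j<i}\sum_{l=0}^{r-1}t_{\zeta_i^ls_{ij}\zeta_i^{-l}}$ and $z_i=y_ix_i+c_0\phi_i$, and let $\mathfrak{t}\subseteq\mathbb{H}$ be the (commutative) subalgebra generated by $z_1,\dots,z_n,t_{\zeta_1},\dots,t_{\zeta_n}$. Let $\lambda=(\lambda^0,\dots,\lambda^{r-1})$ be an $r$-partition of $n$. For a box $b$ of $\lambda^k$ write $\beta(b)=k$ and let $\mathrm{ct}(b)$ be its column index minus its row index. A standard Young tableau $T$ on $\lambda$ is a bijection from $\{1,\dots,n\}$ to the set of boxes of $\lambda$ such that, within each component, the entries increase along rows and down columns; $s_i.T$ is $T$ with $i$ and $i+1$ exchanged. Let $S^\lambda$ be the irreducible $\mathbb{C}W$-module with basis $v_T$ ($T$ a standard Young tableau on $\lambda$) in Young's orthonormal form, that is: $t_{\zeta_i}v_T=\zeta^{\beta(T(i))}v_T$, $\phi_iv_T=r\,\mathrm{ct}(T(i))v_T$,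 and for $1\le i\le n-1$ the element $\tau_i=t_{s_i}+\frac{1}{\phi_i-\phi_{i+1}}\sum_{l=0}^{r-1}t_{\zeta_i\zeta_{i+1}^{-1}}^l$ maps $v_T$ to $0$ if $s_i.T$ is not standard, to $v_{s_i.T}$ if $\beta(T(i))\ne\beta(T(i+1))$, and to $\bigl(1-(\mathrm{ct}(T(i+1))-\mathrm{ct}(T(i)))^{-2}\bigr)^{1/2}v_{s_i.T}$ otherwise. The standard module is $$M(\lambda)=\mathrm{Ind}_{FW\otimes F[y_1,\dots,y_n]}^{\mathbb{H}}(F\otimes_{\mathbb C}S^\lambda),$$ where every $y_i$ acts by $0$ on $F\otimes_{\mathbb C} S^\lambda$. For $\mu\in\mathbb{Z}_{\ge0}^n$ let $\mu^+$ be its non-increasing rearrangement and let $w_\mu\in S_n$ be the longest permutation that rearranges $\mu$ into non-decreasing order, i.e. $w_\mu(i)=|\{j<i:\mu_j<\mu_i\}|+|\{j\ge i:\mu_j\le\mu_i\}|$. Put $v_T^\mu=t_{w_\mu}^{-1}v_T$. Write $\nu<\mu$ if $\nu^+<\mu^+$ in dominance order, or $\nu^+=\mu^+$ and $w_\nu<w_\mu$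 in Bruhat order. Let $f_{\mu,T}\in M(\lambda)$ be the $\mathfrak{t}$-eigenvector (simultaneous eigenvector of all elements of $\mathfrak{t}$) determined by $$f_{\mu,T}\in x^\mu v_T^\mu+\mathrm{span}_F\{x^\nu v_S^\nu : \nu<\mu,\ S\text{ a standard Young tableau on }\lambda\}.$$ **Corollary.** Let $\mu\in\mathbb{Z}_{\ge0}^n$, let $T$ be a standard Young tableau on $\lambda$, and let $1\le i\le n$. If $\mu_j=0$ for all $j\ge i$, then $y_i.f_{\mu,T}=0$ in $M(\lambda)$. -/

import Mathlib

/-!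
The rational Cherednik algebra of type `G(r,1,n)`, its standard modules `M(lam)`, and the
eigenvectors of the commutative subalgebra of Dunkl and Opdam.
All indices are shifted to start at `0`: the set `{1, ..., n}` is `Fin n`.
-/

noncomputable section

namespace Cherednik

/-! ### The group `G(r,1,n)` -/

/-- The group `G(r,1,n)` of `n × n` monomial matrices whose non-zero entries are `r`-th roots
of `1`: the pair `⟨a, σ⟩` stands for the matrix `diag(a) * P_σ`, which sends the standard basis
vector `y_j` to `a_{σ j} y_{σ j}`. -/
abbrev W (r n : ℕ) : Type :=
  (Fin n → rootsOfUnity r ℂ) ⋊[mulAutArrow (G := Equiv.Perm (Fin n))] Equiv.Perm (Fin n)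

section Group

variable (r : ℕ) {n : ℕ}

/-- `ζ = exp(2πi/r)`. -/
def zeta : ℂ := Complex.exp (2 * Real.pi * Complex.I / r)

/-- `ζ` as an element of the group of `r`-th roots of unity. -/
def zetaRoot [NeZero r] : rootsOfUnity r ℂ :=
  (Complex.isPrimitiveRoot_exp r (NeZero.ne r)).toRootsOfUnity

/-- The underlying complex number of `zetaRoot` is `ζ`. -/
theorem coe_zetaRoot [NeZero r] : ((zetaRoot r : ℂˣ) : ℂ) = zeta r := rfl

/-- The permutation matrix of `σ`, as an element of `G(r,1,n)`. -/
def permW (σ : Equiv.Perm (Fin n)) : W r n := SemidirectProduct.inr σ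

/-- `ζ_i = diag(1, ..., ζ, ..., 1)`. -/
def zetaW [NeZero r] (i : Fin n) : W r n :=
  SemidirectProduct.inl (Pi.mulSingle i (zetaRoot r))

/-- The reflection `ζ_i^l s_{ij} ζ_i^{-l}`. -/
def reflW [NeZero r] (i j : Fin n) (l : ℕ) : W r n :=
  zetaW r i ^ l * permW r (Equiv.swap i j) * (zetaW r i ^ l)⁻¹

end Group

/-! ### `r`-partitions and standard Young tableaux -/

/-- An `r`-partition `(lam^0, ..., lam^{r-1})` of `n`. -/
structure RPartition (r n : ℕ) where
  part : Fin r → YoungDiagram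
  sum_card : ∑ k, (part k).card = n

variable {r n : ℕ}

/-- The boxes of an `r`-partition: a component `k` and a cell `(row, column)` of `lam^k`. -/
abbrev Box (lam : RPartition r n) : Type := Σ k : Fin r, {c : ℕ × ℕ // c ∈ (lam.part k).cells}

/-- `β(b) = k` if the box `b` lies in `lam^k`. -/
def beta {lam : RPartition r n} (b : Box lam) : Fin r := b.1

/-- The row of a box. -/
def row {lam : RPartition r n} (b : Box lam) : ℕ := b.2.1.1

/-- The column of a box. -/
def col {lam : RPartition r n} (b : Box lam) : ℕ := b.2.1.2

/-- The content `column - row` of a box. -/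
def ct {lam : RPartition r n} (b : Box lam) : ℤ := (col b : ℤ) - (row b : ℤ)

/-- A filling `T` (where `T i` is the box containing `i`) is standard if within each component the
entries strictly increase along rows from left to right and along columns from top to bottom. -/
def IsStandard {lam : RPartition r n} (T : Fin n ≃ Box lam) : Prop :=
  (∀ b b' : Box lam, beta b = beta b' → row b = row b' → col b < col b' →
    T.symm b < T.symm b') ∧
  (∀ b b' : Box lam, beta b = beta b' → col b = col b' → row b < row b' →
    T.symm b < T.symm b')

/-- The set of standard Young tableaux on `lam`. -/
abbrev SYT (lam : RPartition r n) : Type := {T : Fin n ≃ Box lam // IsStandard T}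

/-! ### The irreducible representations `S^lam` of `G(r,1,n)` -/

section Specht

variable [NeZero r]

/-- `t_w` in the group algebra `ℂ W`. -/
def tW (w : W r n) : MonoidAlgebra ℂ (W r n) := MonoidAlgebra.of ℂ (W r n) w

/-- The Jucys-Murphy element `φ_i = ∑_{j < i} ∑_l t_{ζ_i^l s_{ij} ζ_i^{-l}}`. -/
def jucysMurphy (i : Fin n) : MonoidAlgebra ℂ (W r n) :=
  ∑ j ∈ Finset.univ.filter (fun j : Fin n => j < i), ∑ l ∈ Finset.range r, tW (reflW r i j l)

/-- `π = ∑_l t_{ζ_i ζ_j^{-1}}^l`. -/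
def piW (i j : Fin n) : MonoidAlgebra ℂ (W r n) :=
  ∑ l ∈ Finset.range r, tW (zetaW r i * (zetaW r j)⁻¹) ^ l

open Classical in
/-- The right-hand side of the formula for `τ_i v_T` (where `j = i + 1`), written in terms of a
family `v` indexed by the standard tableaux; `s_i T` is `T` with the entries `i` and `i + 1`
exchanged. -/
def tauRHS {lam : RPartition r n} {V : Type*} [AddCommGroup V] [Module ℂ V]
    (v : SYT lam → V) (T : SYT lam) (i j : Fin n) : V :=
  if h : IsStandard ((Equiv.swap i j).trans T.1) then
    (if beta (T.1 i) = beta (T.1 j) then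
      ((Real.sqrt (1 - (1 / ((ct (T.1 j) : ℝ) - (ct (T.1 i) : ℝ))) ^ 2) : ℝ) : ℂ)
    else 1) • v ⟨(Equiv.swap i j).trans T.1, h⟩
  else 0

/-- The generator `v_T` of the free `ℂ W`-module on the set of standard tableaux. -/
def freeV {lam : RPartition r n} (T : SYT lam) : SYT lam →₀ MonoidAlgebra ℂ (W r n) :=
  Finsupp.single T 1

/-- The relations defining `S^lam`, where `freeV T` stands for `v_T`. -/
inductive SpechtRel (lam : RPartition r n) :
    (SYT lam →₀ MonoidAlgebra ℂ (W r n)) → (SYT lam →₀ MonoidAlgebra ℂ (W r n)) → Prop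
  /-- `t_{ζ_i} v_T = ζ^{β(T(i))} v_T` -/
  | zeta (T : SYT lam) (i : Fin n) :
      SpechtRel lam (tW (zetaW r i) • freeV T)
        ((zeta r ^ (beta (T.1 i) : ℕ)) • freeV T)
  /-- `φ_i v_T = r ct(T(i)) v_T` -/
  | jucysMurphy (T : SYT lam) (i : Fin n) :
      SpechtRel lam (jucysMurphy (r := r) i • freeV T)
        (((r : ℂ) * (ct (T.1 i) : ℂ)) • freeV T)
  /-- the formula for `τ_i v_T`, where `τ_i = t_{s_i} + (φ_i - φ_{i+1})⁻¹ π_i`; by the previous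
  relation `φ_i - φ_{i+1}` acts on `v_T` by the scalar `r (ct(T(i)) - ct(T(i+1)))`, and it
  commutes with `π_i`, which kills `v_T` unless `β(T(i)) = β(T(i+1))` -/
  | tau (T : SYT lam) (i j : Fin n) (hij : (j : ℕ) = (i : ℕ) + 1) :
      SpechtRel lam
        (tW (permW r (Equiv.swap i j)) • freeV T +
          (1 / ((r : ℂ) * (ct (T.1 i) : ℂ) - (r : ℂ) * (ct (T.1 j) : ℂ))) •
            piW (r := r) i j • freeV T)
        (tauRHS freeV T i j)

/-- The `ℂ W`-submodule generated by the relations of `S^lam`. -/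
def spechtRelations (lam : RPartition r n) :
    Submodule (MonoidAlgebra ℂ (W r n)) (SYT lam →₀ MonoidAlgebra ℂ (W r n)) :=
  Submodule.span _ {m | ∃ a b, SpechtRel lam a b ∧ m = a - b}

/-- The irreducible `ℂ W`-module `S^lam` in Young's orthonormal form: the `ℂ W`-module generated
by the vectors `v_T`, for `T` a standard tableau on `lam`, subject to the formulas for the action
of `t_{ζ_i}`, `φ_i` and `τ_i` on them (these vectors are then a basis). -/
abbrev Specht (lam : RPartition r n) : Type :=
  (SYT lam →₀ MonoidAlgebra ℂ (W r n)) ⧸ spechtRelations lam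

/-- The basis vector `v_T` of `S^lam`. -/
def vT {lam : RPartition r n} (T : SYT lam) : Specht lam :=
  (spechtRelations lam).mkQ (freeV T)

end Specht

/-! ### The rational Cherednik algebra -/

/-- The parameters `κ`, `c_0` and `d_j` (`j ∈ ℤ/r`, of sum zero). -/
structure Params (r : ℕ) [NeZero r] (F : Type) [Field F] where
  κ : F
  c₀ : F
  d : ZMod r → F
  sum_d : ∑ j, d j = 0

/-- The generators of the rational Cherednik algebra. -/
inductive Gen (r n : ℕ) : Type
  | x (i : Fin n) : Gen r n
  | y (i : Fin n) : Gen r n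
  | t (w : W r n) : Gen r n

section Algebra

variable [NeZero r] {F : Type} [Field F] [Algebra ℂ F]

local notation "𝐱" => fun i => FreeAlgebra.ι F (Gen.x i)
local notation "𝐲" => fun i => FreeAlgebra.ι F (Gen.y i)
local notation "𝐭" => fun w => FreeAlgebra.ι F (Gen.t w)

/-- The defining relations of the rational Cherednik algebra of `G(r,1,n)`. -/
inductive Rel (P : Params r F) (n : ℕ) :
    FreeAlgebra F (Gen r n) → FreeAlgebra F (Gen r n) → Prop
  | x_comm (i j : Fin n) : Rel P n (𝐱 i * 𝐱 j) (𝐱 j * 𝐱 i)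
  | y_comm (i j : Fin n) : Rel P n (𝐲 i * 𝐲 j) (𝐲 j * 𝐲 i)
  | t_one : Rel P n (𝐭 1) 1
  | t_mul (w w' : W r n) : Rel P n (𝐭 (w * w')) (𝐭 w * 𝐭 w')
  /-- `t_w x = (w x) t_w`, where `w = diag(a) P_σ` sends `x_j` to `a_{σ j}⁻¹ x_{σ j}` -/
  | t_x (w : W r n) (j : Fin n) :
      Rel P n (𝐭 w * 𝐱 j)
        ((algebraMap ℂ F ((w.left (w.right j) : ℂˣ) : ℂ))⁻¹ • 𝐱 (w.right j) * 𝐭 w)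
  /-- `t_w y = (w y) t_w`, where `w = diag(a) P_σ` sends `y_j` to `a_{σ j} y_{σ j}` -/
  | t_y (w : W r n) (j : Fin n) :
      Rel P n (𝐭 w * 𝐲 j)
        ((algebraMap ℂ F ((w.left (w.right j) : ℂˣ) : ℂ)) • 𝐲 (w.right j) * 𝐭 w)
  | y_x_ne (i j : Fin n) (hij : i ≠ j) :
      Rel P n (𝐲 i * 𝐱 j)
        (𝐱 j * 𝐲 i +
          P.c₀ • ∑ l ∈ Finset.range r,
            ((algebraMap ℂ F (zeta r)) ^ l)⁻¹ • 𝐭 (reflW r i j l))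
  /-- here `(r : F)⁻¹ • ∑ l, ζ^{-lj} t_{ζ_i^l}` is the idempotent `e_{ij}` -/
  | y_x_self (i : Fin n) :
      Rel P n (𝐲 i * 𝐱 i)
        (𝐱 i * 𝐲 i + algebraMap F _ P.κ
          - ∑ j ∈ Finset.range r, (P.d (j : ZMod r) - P.d ((j : ZMod r) - 1)) •
              ((r : F)⁻¹ • ∑ l ∈ Finset.range r,
                ((algebraMap ℂ F (zeta r)) ^ (l * j))⁻¹ • 𝐭 (zetaW r i ^ l))
          - P.c₀ • ∑ j ∈ Finset.univ.erase i, ∑ l ∈ Finset.range r, 𝐭 (reflW r i j l))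

/-- The rational Cherednik algebra `ℍ` of `G(r,1,n)` with parameters `P`. -/
def H (P : Params r F) (n : ℕ) : Type := RingQuot (Rel P n)

variable (P : Params r F)

instance : Ring (H P n) := inferInstanceAs (Ring (RingQuot (Rel P n)))

instance : Algebra F (H P n) := inferInstanceAs (Algebra F (RingQuot (Rel P n)))

instance : Algebra ℂ (H P n) := inferInstanceAs (Algebra ℂ (RingQuot (Rel P n)))

instance : IsScalarTower ℂ F (H P n) :=
  inferInstanceAs (IsScalarTower ℂ F (RingQuot (Rel P n)))

/-- The class of a generator in `ℍ`. -/
def gen (g : Gen r n) : H P n := RingQuot.mkAlgHom F (Rel P n) (FreeAlgebra.ι F g)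

/-- The element `x_i` of `ℍ`. -/
def x (i : Fin n) : H P n := gen P (Gen.x i)

/-- The element `y_i` of `ℍ`. -/
def y (i : Fin n) : H P n := gen P (Gen.y i)

/-- The element `t_w` of `ℍ`. -/
def t (w : W r n) : H P n := gen P (Gen.t w)

/-- The monomial `x^μ = x_1^{μ_1} ⋯ x_n^{μ_n}` in `ℍ`. -/
def xPow (μ : Fin n → ℕ) : H P n := (List.ofFn fun i => x P i ^ μ i).prod

/-- The Dunkl-Opdam element `z_i = y_i x_i + c_0 φ_i`. -/
def z (i : Fin n) : H P n :=
  y P i * x P i + P.c₀ • ∑ j ∈ Finset.univ.filter (fun j : Fin n => j < i),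
    ∑ l ∈ Finset.range r, t P (reflW r i j l)

/-- The commutative subalgebra `𝔱` of `ℍ` generated by the `z_i` and the `t_{ζ_i}`. -/
def dunklOpdam (n : ℕ) : Subalgebra F (H P n) :=
  Algebra.adjoin F (Set.range (fun i : Fin n => z P i) ∪
    Set.range (fun i : Fin n => t P (zetaW r i)))

/-! ### The standard module `M(lam)` -/

open scoped TensorProduct in
/-- The `ℍ`-submodule of `ℍ ⊗_ℂ S^lam` generated by `t_w ⊗ v - 1 ⊗ w v` and `y_i ⊗ v`. -/
def vermaRelations (lam : RPartition r n) : Submodule (H P n) (H P n ⊗[ℂ] Specht lam) :=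
  Submodule.span (H P n)
    ({m | ∃ (w : W r n) (v : Specht lam), m = t P w ⊗ₜ[ℂ] v - 1 ⊗ₜ[ℂ] (tW w • v)} ∪
      {m | ∃ (i : Fin n) (v : Specht lam), m = y P i ⊗ₜ[ℂ] v})

open scoped TensorProduct in
/-- The standard module `M(lam)`, induced from the module `F ⊗_ℂ S^lam` over the subalgebra
`F W ⊗ F[y_1, ..., y_n]` of `ℍ`, where every `y_i` acts by zero. -/
abbrev Verma (lam : RPartition r n) : Type :=
  (H P n ⊗[ℂ] Specht lam) ⧸ vermaRelations P lam

open scoped TensorProduct in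
/-- The canonical map from `S^lam` to `M(lam)`. -/
def incl {lam : RPartition r n} (v : Specht lam) : Verma P lam :=
  (vermaRelations P lam).mkQ (1 ⊗ₜ[ℂ] v)

end Algebra

/-! ### The partial order on compositions -/

/-- The values of the permutation `w_μ`, the longest permutation such that `w_μ.μ` is non-decreasing, that is
`w_μ(i) = #{j < i | μ_j < μ_i} + #{j ≥ i | μ_j ≤ μ_i}` in terms of indices starting at `1`; with
indices starting at `0`, the index `j = i` is not counted. -/
def wMuFun (μ : Fin n → ℕ) (i : Fin n) : ℕ :=
  (Finset.univ.filter fun j : Fin n => j < i ∧ μ j < μ i).card +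
    (Finset.univ.filter fun j : Fin n => i < j ∧ μ j ≤ μ i).card

theorem wMuFun_eq (μ : Fin n → ℕ) (i : Fin n) :
    wMuFun μ i =
      (Finset.univ.filter fun j : Fin n => (j < i ∧ μ j < μ i) ∨ (i < j ∧ μ j ≤ μ i)).card := by
  rw [wMuFun, Finset.filter_or, Finset.card_union_of_disjoint]
  rw [Finset.disjoint_filter]
  rintro j - ⟨h1, -⟩ ⟨h2, -⟩
  exact absurd h1 (not_lt.mpr h2.le)

theorem wMuFun_lt (μ : Fin n → ℕ) (i : Fin n) : wMuFun μ i < n := by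
  rw [wMuFun_eq]
  conv_rhs => rw [← Finset.card_fin n]
  refine Finset.card_lt_card ⟨Finset.subset_univ _, fun h => ?_⟩
  have := h (Finset.mem_univ i)
  simp at this

theorem wMuFun_lt_of (μ : Fin n → ℕ) {i k : Fin n}
    (h : (k < i ∧ μ k < μ i) ∨ (i < k ∧ μ k ≤ μ i)) : wMuFun μ k < wMuFun μ i := by
  rw [wMuFun_eq, wMuFun_eq]
  refine Finset.card_lt_card ⟨fun j hj => ?_, fun hs => ?_⟩
  · simp only [Finset.mem_filter, Finset.mem_univ, true_and] at hj ⊢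
    by_cases hji : j = i
    · subst hji; omega
    · have : j < i ∨ i < j := lt_or_gt_of_ne hji
      omega
  · have := hs (Finset.mem_filter.mpr ⟨Finset.mem_univ k, h⟩)
    simp at this

theorem wMuFun_injective (μ : Fin n → ℕ) :
    Function.Injective fun i : Fin n => (⟨wMuFun μ i, wMuFun_lt μ i⟩ : Fin n) := by
  intro i k h
  have h' : wMuFun μ i = wMuFun μ k := by simpa using h
  by_contra hne
  have hlt : i < k ∨ k < i := lt_or_gt_of_ne hne
  have key : ((k < i ∧ μ k < μ i) ∨ (i < k ∧ μ k ≤ μ i)) ∨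
      ((i < k ∧ μ i < μ k) ∨ (k < i ∧ μ i ≤ μ k)) := by omega
  rcases key with h1 | h1
  · exact absurd h' (wMuFun_lt_of μ h1).ne'
  · exact absurd h' (wMuFun_lt_of μ h1).ne

/-- The permutation `w_μ` with values `wMuFun μ`. -/
def wMu (μ : Fin n → ℕ) : Equiv.Perm (Fin n) :=
  Equiv.ofBijective _ (Finite.injective_iff_bijective.mp (wMuFun_injective μ))

/-- The non-increasing rearrangement `μ^+`. -/
def sortDesc (μ : Fin n → ℕ) (i : Fin n) : ℕ := μ ((wMu μ).symm (Fin.rev i))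

/-- The strict dominance order on partitions of the same size. -/
def DomLT (p q : Fin n → ℕ) : Prop :=
  p ≠ q ∧ ∑ i, p i = ∑ i, q i ∧
    ∀ m : ℕ, ∑ i ∈ Finset.univ.filter (fun i : Fin n => (i : ℕ) < m), p i ≤
      ∑ i ∈ Finset.univ.filter (fun i : Fin n => (i : ℕ) < m), q i

/-- The length of a permutation: its number of inversions. -/
def len (w : Equiv.Perm (Fin n)) : ℕ :=
  (Finset.univ.filter fun p : Fin n × Fin n => p.1 < p.2 ∧ w p.2 < w p.1).card

/-- The strict Bruhat order on `S_n`, generated by the relations `u < u (a b)` for transpositions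
`(a b)` that increase the length. -/
def BruhatLT : Equiv.Perm (Fin n) → Equiv.Perm (Fin n) → Prop :=
  Relation.TransGen fun u w => ∃ a b : Fin n, a ≠ b ∧ w = u * Equiv.swap a b ∧ len u < len w

/-- The partial order on compositions: `μ < ν` if `μ^+ < ν^+` in dominance order, or
`μ^+ = ν^+` and `w_μ < w_ν` in Bruhat order. -/
def CompLT (μ ν : Fin n → ℕ) : Prop :=
  DomLT (sortDesc μ) (sortDesc ν) ∨ (sortDesc μ = sortDesc ν ∧ BruhatLT (wMu μ) (wMu ν))

/-! ### The eigenvectors `f_{μ,T}` -/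

section Eigenvectors

variable [NeZero r] {F : Type} [Field F] [Algebra ℂ F] (P : Params r F)

/-- The element `x^μ v_T^μ` of `M(lam)`, where `v_T^μ = w_μ⁻¹ v_T`. -/
def xv {lam : RPartition r n} (μ : Fin n → ℕ) (T : SYT lam) : Verma P lam :=
  xPow P μ • incl P (tW (permW r (wMu μ)⁻¹) • vT T)

/-- `f` is a `𝔱`-eigenvector. -/
def IsEigenvector {lam : RPartition r n} (f : Verma P lam) : Prop :=
  f ≠ 0 ∧ ∀ h ∈ dunklOpdam P n, ∃ a : F, h • f = a • f

/-- The property that characterizes `f_{μ,T}`: it is a `𝔱`-eigenvector and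
`f_{μ,T} = x^μ v_T^μ + lower terms`. -/
def IsJack {lam : RPartition r n} (μ : Fin n → ℕ) (T : SYT lam) (f : Verma P lam) : Prop :=
  IsEigenvector P f ∧
    f - xv P μ T ∈ Submodule.span F {m | ∃ (ν : Fin n → ℕ) (S : SYT lam),
      CompLT ν μ ∧ m = xv P ν S}

end Eigenvectors

/-! ### Generic parameters -/

/-- The indeterminates `κ`, `c_0` and `d_j` for `j ≠ 0` in `ℤ/r`. -/
inductive ParamVar (r : ℕ) : Type
  | κ : ParamVar r
  | c₀ : ParamVar r
  | d (j : ZMod r) (hj : j ≠ 0) : ParamVar r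

/-- The field `ℂ(κ, c_0, d_1, ..., d_{r-1})`. -/
abbrev ParamField (r : ℕ) : Type := FractionRing (MvPolynomial (ParamVar r) ℂ)

/-- An indeterminate as an element of the field of rational functions. -/
def pvar (v : ParamVar r) : ParamField r :=
  algebraMap (MvPolynomial (ParamVar r) ℂ) (ParamField r) (MvPolynomial.X v)

/-- The generic parameters: `κ`, `c_0`, `d_1, ..., d_{r-1}` are the indeterminates and
`d_0 = -(d_1 + ⋯ + d_{r-1})`. -/
def generic (r : ℕ) [NeZero r] : Params r (ParamField r) where
  κ := pvar ParamVar.κ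
  c₀ := pvar ParamVar.c₀
  d j := if hj : j = 0 then -∑ k : {k : ZMod r // k ≠ 0}, pvar (ParamVar.d k.1 k.2)
    else pvar (ParamVar.d j hj)
  sum_d := by
    rw [← Finset.add_sum_erase _ _ (Finset.mem_univ (0 : ZMod r)), dif_pos rfl, neg_add_eq_zero,
      Finset.sum_subtype (p := fun k : ZMod r => k ≠ 0) _ (by simp)]
    exact Finset.sum_congr rfl fun k _ => by rw [dif_neg k.2]

end Cherednik

end

/-! The argument measures sizes by the degree in `κ`. By the triangular decomposition the standard
module sits inside `F[x_1, ..., x_n] ⊗ S^lam`, where `y_i` acts by a Dunkl operator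
(`exists_toModel_injective`). Give `F` the valuation `v` of the degree in `κ`: then `v κ > 1`, while
`c_0`, the `d_j` and all complex constants have valuation at most `1`. In the basis of monomials
times basis vectors of `S^lam`, the operators `x_k` and `t_w` have integral matrices, and `x_i y_i`
is `κ` times the degree in `x_i` plus an integral operator (`opXY_sub_mem_bounded`). On the image of
`x_i` this degree is a positive integer, a unit for `v`, so `x_i y_i` stretches vectors there by
exactly `v κ`.

The eigenvector, on the other hand, does not see this stretching. In `z_j` the reflections with `k <
j` cancel, so `x_j y_j f = (α_j - κ) f + (integral combination of u f)`, where `u` runs over powers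
of `ζ_j` and reflections in `j` and some `k > j` (`modelHom_z`). For `j ≥ i` these `u` fix `x^μ`,
and `x_j y_j f` has no `x^μ` term because `μ_j = 0`; comparing coefficients of `x^μ` shows that `α_j
- κ` is integral (`eigenvalue_sub_kappa_le`).

Now let `w` run over the elements of `W` that preserve the set of indices `≥ i`, and put `h_w = x_i
y_i w f`. Since `h_w = w x_j y_j f` with `w(j) = i`, the vector `x_i y_i h_w` is an integral
combination of vectors `h_{wu}`. A common bound for all `h_w` is therefore also one for all `x_i y_i
h_w`, and by the stretching it can be divided by `v κ`. Iterating, every `h_w` vanishes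
(`eq_zero_of_opXY_stable`, `dunkl_eq_zero`). With `w = 1` this is `x_i y_i f = 0`, and `x_i` is
injective.

The coefficient comparison needs a nonzero leading vector. As `S^lam` is given by generators and
relations, this is derived from `f ≠ 0`: if one `v_T` vanishes, then all do (`specht_eq_zero`). The
only property of the order on compositions that matters is irreflexivity. -/

noncomputable section

namespace Cherednik

open scoped TensorProduct

/-! ### Operators on `F[x_1, ..., x_n] ⊗ S` -/

open scoped IsMulCommutative in
/-- Evaluation of polynomials at a commuting family of elements of an algebra. -/
theorem exists_algHom_of_commute {F σ A : Type*} [CommRing F] [Ring A] [Algebra F A] (a : σ → A)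
    (h : ∀ i j, a i * a j = a j * a i) :
    ∃ Φ : MvPolynomial σ F →ₐ[F] A, ∀ i, Φ (MvPolynomial.X i) = a i := by
  have hc : ∀ u ∈ Set.range a, ∀ v ∈ Set.range a, u * v = v * u := by
    rintro _ ⟨i, rfl⟩ _ ⟨j, rfl⟩
    exact h i j
  have := Algebra.isMulCommutative_adjoin F hc
  let b : σ → Algebra.adjoin F (Set.range a) := fun i => ⟨a i, Algebra.subset_adjoin ⟨i, rfl⟩⟩
  exact ⟨(Algebra.adjoin F (Set.range a)).val.comp (MvPolynomial.aeval b), fun i => by simp [b]⟩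

section PolyTensor

variable {F : Type} [Field F] [Algebra ℂ F] {n : ℕ}

/-- The space `F[x_1, ..., x_n] ⊗_ℂ S`. -/
abbrev PolyTensor (F : Type) [Field F] [Algebra ℂ F] (n : ℕ) (S : Type*) [AddCommGroup S]
    [Module ℂ S] : Type _ :=
  MvPolynomial (Fin n) F ⊗[ℂ] S

/-- The variable `x_k` as a polynomial over `F`. -/
abbrev polyX (F : Type) [Field F] (k : Fin n) : MvPolynomial (Fin n) F := MvPolynomial.X k

variable {S : Type*} [AddCommGroup S] [Module ℂ S]

theorem PolyTensor.induction {p : PolyTensor F n S → Prop} (one : ∀ s, p (1 ⊗ₜ s))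
    (add : ∀ g g', p g → p g' → p (g + g')) (smul : ∀ (c : F) g, p g → p (c • g))
    (X : ∀ (k : Fin n) g, p g → p (polyX F k • g)) (g : PolyTensor F n S) :
    p g := by
  induction g using TensorProduct.induction_on with
  | zero => simpa using one 0
  | add g g' hg hg' => exact add g g' hg hg'
  | tmul q s =>
    induction q using MvPolynomial.induction_on with
    | C a =>
      have := smul a _ (one s)
      rwa [TensorProduct.smul_tmul', MvPolynomial.smul_eq_C_mul, mul_one] at this
    | add q q' hq hq' => rw [TensorProduct.add_tmul]; exact add _ _ hq hq'
    | mul_X q k hq =>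
      have := X k _ hq
      rwa [TensorProduct.smul_tmul', smul_eq_mul, mul_comm] at this

/-- The hypothesis `X` is one induction step, so two operators agree as soon as they agree on `1 ⊗
S` and obey the same commutation rule with the variables. All operator identities of the polynomial
model are checked this way. -/
theorem PolyTensor.hom_ext {E : Type*} [AddCommGroup E] [Module F E]
    {φ ψ : PolyTensor F n S →ₗ[F] E} (one : ∀ s, φ (1 ⊗ₜ s) = ψ (1 ⊗ₜ s))
    (X : ∀ (k : Fin n) g, φ g = ψ g → φ (polyX F k • g) =
      ψ (polyX F k • g)) : φ = ψ :=
  LinearMap.ext <| PolyTensor.induction one (fun g g' h h' => by rw [map_add, map_add, h, h'])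
    (fun c g h => by rw [map_smul, map_smul, h]) X

/-- The extension of a linear map on `S` to `F[x_1, ..., x_n] ⊗ S`, where the variables act by
commuting operators. -/
theorem exists_polyTensor_lift {E : Type*} [AddCommGroup E] [Module F E] [Module ℂ E]
    [IsScalarTower ℂ F E] (ξ : Fin n → Module.End F E) (h : ∀ i j, ξ i * ξ j = ξ j * ξ i)
    (u : S →ₗ[ℂ] E) :
    ∃ Λ : PolyTensor F n S →ₗ[F] E, (∀ s, Λ (1 ⊗ₜ s) = u s) ∧
      ∀ k g, Λ (polyX F k • g) = ξ k (Λ g) := by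
  obtain ⟨Φ, hΦ⟩ := exists_algHom_of_commute (F := F) ξ h
  let B : MvPolynomial (Fin n) F →ₗ[F] S →ₗ[ℂ] E :=
    { toFun := fun p => ((Φ p).restrictScalars ℂ).comp u
      map_add' := fun p q => by ext; simp
      map_smul' := fun c p => by ext; simp }
  refine ⟨TensorProduct.AlgebraTensorModule.lift B, fun s => by simp [B], fun k g => ?_⟩
  induction g using TensorProduct.induction_on with
  | zero => simp
  | add g g' hg hg' => simp only [smul_add, map_add, hg, hg']
  | tmul q s => simp [TensorProduct.smul_tmul', B, hΦ]

/-- The extension of a family of operators to a twisted derivation. -/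
theorem exists_twisted_derivation (G : Fin n → Module.End F (PolyTensor F n S))
    (hG : ∀ k l g,
      polyX F k • G l g +
        G k (polyX F l • g) =
      polyX F l • G k g +
        G l (polyX F k • g)) :
    ∃ D : Module.End F (PolyTensor F n S), (∀ s, D (1 ⊗ₜ s) = 0) ∧
      ∀ k g, D (polyX F k • g) =
        polyX F k • D g + G k g := by
  let N := PolyTensor F n S
  let X : Fin n → Module.End F N := fun k => Algebra.lsmul F F N (polyX F k)
  have hX : ∀ k g, X k g = polyX F k • g := fun _ _ => rfl
  -- A twisted derivation is an algebra action by upper triangular 2 × 2 matrices with `x_k` on the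
  -- diagonal and `G k` in the corner. The hypothesis `hG` says exactly that these matrices commute;
  -- `D` is the first component of the resulting lift of `s ↦ (0, 1 ⊗ s)`.
  let ξ : Fin n → Module.End F (N × N) := fun k =>
    (X k ∘ₗ LinearMap.fst F N N + G k ∘ₗ LinearMap.snd F N N).prod (X k ∘ₗ LinearMap.snd F N N)
  have hξ : ∀ k g, ξ k g = (polyX F k • g.1 + G k g.2,
    polyX F k • g.2) := fun _ _ => rfl
  have hc : ∀ i j, ξ i * ξ j = ξ j * ξ i := by
    intro i j
    refine LinearMap.ext fun g => ?_
    simp only [Module.End.mul_apply, hξ, smul_add, Prod.mk.injEq, smul_smul]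
    rw [mul_comm (polyX F j)]
    refine ⟨?_, rfl⟩
    rw [add_assoc, add_assoc, hG]
  let u : S →ₗ[ℂ] N × N := LinearMap.prod 0 (TensorProduct.mk ℂ (MvPolynomial (Fin n) F) S 1)
  obtain ⟨Λ, h1, h2⟩ := exists_polyTensor_lift ξ hc u
  have h3 : LinearMap.snd F N N ∘ₗ Λ = LinearMap.id := by
    refine PolyTensor.hom_ext (fun s => by rw [LinearMap.comp_apply, h1]; rfl) fun k g hg => ?_
    simp only [LinearMap.comp_apply, LinearMap.snd_apply, LinearMap.id_apply] at hg ⊢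
    rw [h2, hξ, hg]
  refine ⟨LinearMap.fst F N N ∘ₗ Λ, fun s => by simp [h1, u], fun k g => ?_⟩
  have h4 : (Λ g).2 = g := LinearMap.congr_fun h3 g
  simp only [LinearMap.comp_apply, LinearMap.fst_apply, h2, hξ, h4]

end PolyTensor

/-! ### Commutation relations in the group algebra part -/

section Roots

variable {r n : ℕ}

/-- `ζ_i^l s_{ik} ζ_i^{-l}` with an arbitrary root of unity in place of `ζ^l`. -/
def reflRoot (i k : Fin n) (a : rootsOfUnity r ℂ) : W r n :=
  ⟨Pi.mulSingle i a * Pi.mulSingle k a⁻¹, Equiv.swap i k⟩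

theorem reflRoot_swap (i k : Fin n) (a : rootsOfUnity r ℂ) :
    reflRoot i k a⁻¹ = reflRoot k i a := by
  rw [reflRoot, reflRoot, inv_inv, mul_comm, Equiv.swap_comm]

variable {F : Type} [Field F] [Algebra ℂ F]

/-- A root of unity as an element of the field `F`. -/
def rootF (F : Type) [Field F] [Algebra ℂ F] (a : rootsOfUnity r ℂ) : F :=
  algebraMap ℂ F ((a : ℂˣ) : ℂ)

theorem rootF_ne_zero (a : rootsOfUnity r ℂ) : rootF F a ≠ 0 := by
  rw [rootF, Ne, map_eq_zero]
  exact Units.ne_zero _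

@[simp]
theorem rootF_one : rootF F (1 : rootsOfUnity r ℂ) = 1 := by simp [rootF]

theorem rootF_mul (a b : rootsOfUnity r ℂ) : rootF F (a * b) = rootF F a * rootF F b := by
  simp [rootF]

@[simp]
theorem rootF_inv (a : rootsOfUnity r ℂ) : rootF F a⁻¹ = (rootF F a)⁻¹ := by
  simp [rootF]

/-- The scalar `a` such that `w y_j = a y_{w(j)}`. -/
def coefW (F : Type) [Field F] [Algebra ℂ F] (w : W r n) (j : Fin n) : F :=
  rootF F (w.left (w.right j))

theorem coefW_ne_zero (w : W r n) (j : Fin n) : coefW F w j ≠ 0 := rootF_ne_zero _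

@[simp]
theorem coefW_one (j : Fin n) : coefW F (1 : W r n) j = 1 := rootF_one

theorem coefW_mul (w w' : W r n) (j : Fin n) :
    coefW F (w * w') j = coefW F w (w'.right j) * coefW F w' j := by
  rw [coefW, coefW, coefW, ← rootF_mul]
  congr 1
  rw [SemidirectProduct.mul_left, SemidirectProduct.mul_right, Pi.mul_apply]
  congr 1
  change w'.left (w.right⁻¹ (w.right (w'.right j))) = _
  rw [Equiv.Perm.inv_def, Equiv.symm_apply_apply]

theorem mulAutArrow_mulSingle {G : Type*} [Group G] (σ : Equiv.Perm (Fin n)) (i : Fin n) (a : G) :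
    mulAutArrow (G := Equiv.Perm (Fin n)) σ (Pi.mulSingle i a) = Pi.mulSingle (σ i) a := by
  ext j
  change (Pi.mulSingle i a : Fin n → G) (σ⁻¹ • j) = _
  simp only [Pi.mulSingle_apply, Equiv.Perm.smul_def, Equiv.Perm.inv_def, Equiv.symm_apply_eq]

/-- Conjugation by `w` relabels the indices and multiplies the root of unity by a ratio of entries
of `w`, so that sums over all roots are merely reindexed. -/
theorem mul_reflRoot (w : W r n) {i k : Fin n} (h : i ≠ k) (a : rootsOfUnity r ℂ) :
    w * reflRoot i k a = reflRoot (w.right i) (w.right k)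
      (w.left (w.right i) * (w.left (w.right k))⁻¹ * a) * w := by
  have h' : w.right i ≠ w.right k := w.right.injective.ne h
  refine SemidirectProduct.ext (funext fun m => ?_) ?_
  · simp only [SemidirectProduct.mul_left, reflRoot, map_mul, mulAutArrow_mulSingle, Pi.mul_apply]
    change _ = _ * w.left ((Equiv.swap (w.right i) (w.right k))⁻¹ m)
    rw [Equiv.swap_inv]
    by_cases h1 : m = w.right i
    · subst h1
      simp [Pi.mulSingle_eq_of_ne h', mul_comm, mul_left_comm]
    by_cases h2 : m = w.right k
    · subst h2
      simp [Pi.mulSingle_eq_of_ne h'.symm, mul_comm, mul_left_comm]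
    · simp [Pi.mulSingle_eq_of_ne h1, Pi.mulSingle_eq_of_ne h2,
        Equiv.swap_apply_of_ne_of_ne h1 h2]
  · simp only [SemidirectProduct.mul_right, reflRoot]
    rw [Equiv.mul_swap_eq_swap_mul]

end Roots

/-! ### The elements `ζ_i^l` and `ζ_i^l s_{ik} ζ_i^{-l}`. -/

section GroupElements

variable {r n : ℕ} [NeZero r]

@[simp]
theorem zetaW_pow_left (i : Fin n) (l : ℕ) :
    (zetaW r i ^ l).left = Pi.mulSingle i (zetaRoot r ^ l) := by
  rw [zetaW, ← map_pow, SemidirectProduct.left_inl, Pi.mulSingle_pow]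

@[simp]
theorem zetaW_pow_right (i : Fin n) (l : ℕ) : (zetaW r i ^ l).right = 1 := by
  rw [zetaW, ← map_pow, SemidirectProduct.right_inl]

@[simp]
theorem reflW_right (i k : Fin n) (l : ℕ) : (reflW r i k l).right = Equiv.swap i k := by
  simp [reflW, permW]

theorem reflW_left (i k : Fin n) (l : ℕ) :
    (reflW r i k l).left =
      Pi.mulSingle i (zetaRoot r ^ l) * Pi.mulSingle k (zetaRoot r ^ l)⁻¹ := by
  rw [reflW, zetaW, ← map_pow, ← map_inv, permW, ← Pi.mulSingle_pow, ← Pi.mulSingle_inv]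
  simp only [SemidirectProduct.mul_left, SemidirectProduct.mul_right, SemidirectProduct.left_inl,
    SemidirectProduct.left_inr, SemidirectProduct.right_inl, SemidirectProduct.right_inr, map_one,
    mul_one, one_mul]
  rw [mulAutArrow_mulSingle, Equiv.swap_apply_left]

instance fintypeRootsOfUnity : Fintype (rootsOfUnity r ℂ) := Fintype.ofFinite _

/-- A sum over the whole group of roots of unity can be reindexed by inversion and by translation,
unlike a sum over exponents. -/
theorem sum_zetaRoot_pow {M : Type*} [AddCommMonoid M] (φ : rootsOfUnity r ℂ → M) :
    ∑ l ∈ Finset.range r, φ (zetaRoot r ^ l) = ∑ a, φ a := by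
  have hp : IsPrimitiveRoot (zetaRoot r : ℂˣ) r :=
    IsPrimitiveRoot.coe_units_iff.mp (Complex.isPrimitiveRoot_exp r (NeZero.ne r))
  refine Finset.sum_nbij (fun l => zetaRoot r ^ l) (fun _ _ => Finset.mem_univ _) ?_ ?_
    fun _ _ => rfl
  · intro l hl m hm h
    exact hp.pow_inj (Finset.mem_range.mp hl) (Finset.mem_range.mp hm) (congrArg Subtype.val h)
  · intro a _
    obtain ⟨l, hl, h⟩ := hp.eq_pow_of_mem_rootsOfUnity a.2
    exact ⟨l, Finset.mem_coe.mpr (Finset.mem_range.mpr hl), Subtype.ext h⟩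

variable {F : Type} [Field F] [Algebra ℂ F]

theorem rootF_zetaRoot_pow (l : ℕ) : rootF F (zetaRoot r ^ l) = algebraMap ℂ F (zeta r) ^ l := by
  rw [rootF, ← coe_zetaRoot]; simp

theorem coefW_zetaW_pow_of_ne {i m : Fin n} (h : m ≠ i) (l : ℕ) :
    coefW F (zetaW r i ^ l) m = 1 := by
  rw [coefW, zetaW_pow_left, zetaW_pow_right, Equiv.Perm.one_apply, Pi.mulSingle_eq_of_ne h,
    rootF_one]

theorem coefW_reflW_left {i k : Fin n} (h : i ≠ k) (l : ℕ) :
    coefW F (reflW r i k l) i = (algebraMap ℂ F (zeta r) ^ l)⁻¹ := by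
  rw [coefW, reflW_right, Equiv.swap_apply_left, reflW_left, Pi.mul_apply,
    Pi.mulSingle_eq_of_ne h.symm, Pi.mulSingle_eq_same, one_mul, rootF_inv, rootF_zetaRoot_pow]

theorem coefW_reflW_right {i k : Fin n} (h : i ≠ k) (l : ℕ) :
    coefW F (reflW r i k l) k = algebraMap ℂ F (zeta r) ^ l := by
  rw [coefW, reflW_right, Equiv.swap_apply_right, reflW_left, Pi.mul_apply,
    Pi.mulSingle_eq_of_ne h, Pi.mulSingle_eq_same, mul_one, rootF_zetaRoot_pow]

theorem coefW_reflW_of_ne {i k m : Fin n} (hi : m ≠ i) (hk : m ≠ k) (l : ℕ) :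
    coefW F (reflW r i k l) m = 1 := by
  rw [coefW, reflW_right, Equiv.swap_apply_of_ne_of_ne hi hk, reflW_left, Pi.mul_apply,
    Pi.mulSingle_eq_of_ne hi, Pi.mulSingle_eq_of_ne hk, mul_one, rootF_one]

theorem mul_zetaW_pow (w : W r n) (i : Fin n) (l : ℕ) :
    w * zetaW r i ^ l = zetaW r (w.right i) ^ l * w := by
  refine SemidirectProduct.ext ?_ ?_
  · simp only [SemidirectProduct.mul_left, zetaW_pow_left, zetaW_pow_right, mulAutArrow_mulSingle]
    rw [map_one, MulAut.one_apply, mul_comm]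
  · simp

theorem reflW_eq_reflRoot (i k : Fin n) (l : ℕ) :
    reflW r i k l = reflRoot i k (zetaRoot r ^ l) :=
  SemidirectProduct.ext (reflW_left i k l) (reflW_right i k l)

end GroupElements

/-! ### The commutators `[y_i, x_k]`, in an algebra general enough to cover both `ℍ` and the
operators of the model. -/

section CrossTerm

variable {r n : ℕ} [NeZero r] {F : Type} [Field F] [Algebra ℂ F] {A : Type*} [Ring A] [Algebra F A]

/-- `∑_l t_{ζ_i^l s_{ik} ζ_i^{-l}}`. -/
def reflSum (T : W r n → A) (i k : Fin n) : A := ∑ l ∈ Finset.range r, T (reflW r i k l)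

/-- `∑_l ζ^{-l} t_{ζ_i^l s_{ik} ζ_i^{-l}}`. -/
def reflSumZeta (F : Type) [Field F] [Algebra ℂ F] [Algebra F A] (T : W r n → A) (i k : Fin n) :
    A :=
  ∑ l ∈ Finset.range r, (algebraMap ℂ F (zeta r) ^ l)⁻¹ • T (reflW r i k l)

/-- `∑_j (d_j - d_{j-1}) e_{ij}`. -/
def diagSum (P : Params r F) (T : W r n → A) (i : Fin n) : A :=
  ∑ j ∈ Finset.range r, (P.d (j : ZMod r) - P.d ((j : ZMod r) - 1)) •
    ((r : F)⁻¹ • ∑ l ∈ Finset.range r,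
      ((algebraMap ℂ F (zeta r)) ^ (l * j))⁻¹ • T (zetaW r i ^ l))

/-- The difference `y_i x_k - x_k y_i`, where `T w` stands for `t_w`. -/
def crossTerm (P : Params r F) (T : W r n → A) (i k : Fin n) : A :=
  if i = k then
    algebraMap F A P.κ - diagSum P T i - P.c₀ • ∑ j ∈ Finset.univ.erase i, reflSum T i j
  else P.c₀ • reflSumZeta F T i k

theorem reflSum_comm (T : W r n → A) (i k : Fin n) : reflSum T i k = reflSum T k i := by
  simp only [reflSum, reflW_eq_reflRoot]
  rw [sum_zetaRoot_pow fun a => T (reflRoot i k a), sum_zetaRoot_pow fun a => T (reflRoot k i a),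
    ← Equiv.sum_comp (Equiv.inv _) fun a => T (reflRoot i k a)]
  simp only [Equiv.inv_apply, reflRoot_swap]

theorem reflSumZeta_comm (T : W r n → A) (i k : Fin n) :
    reflSumZeta F T k i =
      ∑ l ∈ Finset.range r, algebraMap ℂ F (zeta r) ^ l • T (reflW r i k l) := by
  simp only [reflSumZeta, reflW_eq_reflRoot, ← rootF_zetaRoot_pow]
  rw [sum_zetaRoot_pow fun a => (rootF F a)⁻¹ • T (reflRoot k i a),
    sum_zetaRoot_pow fun a => rootF F a • T (reflRoot i k a),
    ← Equiv.sum_comp (Equiv.inv _) fun a => (rootF F a)⁻¹ • T (reflRoot k i a)]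
  simp only [Equiv.inv_apply, reflRoot_swap, rootF_inv, inv_inv]

/-! ### Equivariance of the commutators under `W`. -/

section Conjugation

variable {T : W r n → A}

theorem mul_reflSum (hT : ∀ w w', T (w * w') = T w * T w') (w : W r n)
    {i k : Fin n} (h : i ≠ k) :
    T w * reflSum T i k = reflSum T (w.right i) (w.right k) * T w := by
  simp only [reflSum, reflW_eq_reflRoot]
  rw [sum_zetaRoot_pow fun a => T (reflRoot i k a),
    sum_zetaRoot_pow fun a => T (reflRoot (w.right i) (w.right k) a),
    ← Equiv.sum_comp (Equiv.mulLeft (w.left (w.right i) * (w.left (w.right k))⁻¹))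
      fun a => T (reflRoot (w.right i) (w.right k) a), Finset.mul_sum, Finset.sum_mul]
  refine Finset.sum_congr rfl fun a _ => ?_
  rw [← hT, mul_reflRoot w h, hT, Equiv.coe_mulLeft]

theorem mul_reflSumZeta (hT : ∀ w w', T (w * w') = T w * T w') (w : W r n)
    {i k : Fin n} (h : i ≠ k) :
    T w * reflSumZeta F T i k =
      (coefW F w i * (coefW F w k)⁻¹) • (reflSumZeta F T (w.right i) (w.right k) * T w) := by
  simp only [reflSumZeta, reflW_eq_reflRoot, ← rootF_zetaRoot_pow]
  rw [sum_zetaRoot_pow fun a => (rootF F a)⁻¹ • T (reflRoot i k a),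
    sum_zetaRoot_pow fun a => (rootF F a)⁻¹ • T (reflRoot (w.right i) (w.right k) a),
    ← Equiv.sum_comp (Equiv.mulLeft (w.left (w.right i) * (w.left (w.right k))⁻¹))
      fun a => (rootF F a)⁻¹ • T (reflRoot (w.right i) (w.right k) a), Finset.mul_sum,
    Finset.sum_mul, Finset.smul_sum]
  refine Finset.sum_congr rfl fun a _ => ?_
  have h1 := coefW_ne_zero (F := F) w i
  have h2 := coefW_ne_zero (F := F) w k
  rw [mul_smul_comm, ← hT, mul_reflRoot w h, hT, Equiv.coe_mulLeft, smul_mul_assoc, smul_smul,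
    rootF_mul, rootF_mul, rootF_inv]
  congr 1
  rw [coefW] at h1 h2 ⊢
  rw [coefW]
  field_simp

theorem mul_diagSum (hT : ∀ w w', T (w * w') = T w * T w') (P : Params r F)
    (w : W r n) (i : Fin n) :
    T w * diagSum P T i = diagSum P T (w.right i) * T w := by
  simp only [diagSum, Finset.mul_sum, Finset.sum_mul, mul_smul_comm, smul_mul_assoc, ← hT,
    mul_zetaW_pow]

theorem mul_crossTerm (hT : ∀ w w', T (w * w') = T w * T w') (P : Params r F)
    (w : W r n) (i k : Fin n) :
    T w * crossTerm P T i k =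
      (coefW F w i * (coefW F w k)⁻¹) • (crossTerm P T (w.right i) (w.right k) * T w) := by
  by_cases h : i = k
  · subst h
    have h1 : T w * ∑ j ∈ Finset.univ.erase i, reflSum T i j =
        (∑ j ∈ Finset.univ.erase (w.right i), reflSum T (w.right i) j) * T w := by
      rw [Finset.mul_sum, Finset.sum_mul]
      refine Finset.sum_nbij' (fun j => w.right j) (fun j => w.right.symm j) ?_ ?_ ?_ ?_ ?_
      · simp
      · simp [Equiv.symm_apply_eq]
      · simp
      · simp
      · intro j hj
        exact mul_reflSum hT w (Finset.ne_of_mem_erase hj).symm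
    rw [crossTerm, crossTerm, if_pos rfl, if_pos rfl, mul_inv_cancel₀ (coefW_ne_zero w i),
      one_smul, mul_sub, mul_sub, sub_mul, sub_mul, mul_diagSum hT, mul_smul_comm, h1,
      smul_mul_assoc, Algebra.commutes]
  · rw [crossTerm, crossTerm, if_neg h, if_neg (w.right.injective.ne h), mul_smul_comm,
      mul_reflSumZeta hT w h, smul_mul_assoc, smul_comm]

end Conjugation

section Commute

variable {T : W r n → A} {U : A}

theorem commute_reflSum {i k : Fin n} (h : ∀ l, Commute (T (reflW r i k l)) U) :
    Commute (reflSum T i k) U :=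
  Commute.sum_left _ _ _ fun l _ => h l

theorem commute_reflSumZeta {i k : Fin n} (h : ∀ l, Commute (T (reflW r i k l)) U) :
    Commute (reflSumZeta F T i k) U :=
  Commute.sum_left _ _ _ fun l _ => (h l).smul_left _

theorem commute_diagSum (P : Params r F) {i : Fin n} (h : ∀ l, Commute (T (zetaW r i ^ l)) U) :
    Commute (diagSum P T i) U :=
  Commute.sum_left _ _ _ fun _ _ => Commute.smul_left (Commute.smul_left
    (Commute.sum_left _ _ _ fun l _ => (h l).smul_left _) _) _

end Commute

/-! ### Compatibility of the commutators with the commuting variables `x_k`. -/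

section X

variable {X : Fin n → A} {T : W r n → A}

theorem commute_reflW_X (hT : ∀ w j, T w * X j = (coefW F w j)⁻¹ • X (w.right j) * T w)
    {i k m : Fin n} (hi : m ≠ i) (hk : m ≠ k) (l : ℕ) : Commute (T (reflW r i k l)) (X m) := by
  have := hT (reflW r i k l) m
  rwa [coefW_reflW_of_ne hi hk, inv_one, one_smul, reflW_right,
    Equiv.swap_apply_of_ne_of_ne hi hk] at this

theorem commute_zetaW_X (hT : ∀ w j, T w * X j = (coefW F w j)⁻¹ • X (w.right j) * T w)
    {i m : Fin n} (hi : m ≠ i) (l : ℕ) : Commute (T (zetaW r i ^ l)) (X m) := by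
  have := hT (zetaW r i ^ l) m
  rwa [coefW_zetaW_pow_of_ne hi, inv_one, one_smul, zetaW_pow_right,
    Equiv.Perm.one_apply] at this

theorem reflSum_mul_X (hT : ∀ w j, T w * X j = (coefW F w j)⁻¹ • X (w.right j) * T w)
    {i k : Fin n} (h : i ≠ k) : reflSum T i k * X k = X i * reflSumZeta F T i k := by
  rw [reflSum, reflSumZeta, Finset.sum_mul, Finset.mul_sum]
  refine Finset.sum_congr rfl fun l _ => ?_
  rw [hT, coefW_reflW_right h, reflW_right, Equiv.swap_apply_right, smul_mul_assoc,
    mul_smul_comm]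

theorem reflSumZeta_mul_X (hT : ∀ w j, T w * X j = (coefW F w j)⁻¹ • X (w.right j) * T w)
    {i k : Fin n} (h : i ≠ k) : reflSumZeta F T i k * X i = X k * reflSum T i k := by
  rw [reflSum, reflSumZeta, Finset.sum_mul, Finset.mul_sum]
  refine Finset.sum_congr rfl fun l _ => ?_
  have h0 : algebraMap ℂ F (zeta r) ^ l ≠ 0 := by
    rw [← rootF_zetaRoot_pow]; exact rootF_ne_zero _
  rw [smul_mul_assoc, hT, coefW_reflW_left h, reflW_right, Equiv.swap_apply_left, smul_mul_assoc,
    smul_smul, inv_inv, inv_mul_cancel₀ h0, one_smul]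

/-- In `[y_i, x_i]` everything except the reflections in `i` and `k` commutes with `x_k`. Moving a
variable past those reflections exchanges `reflSum` with `reflSumZeta`, which gives precisely the
contribution of `[y_i, x_k]`. -/
theorem crossTerm_self_X (P : Params r F)
    (hT : ∀ w j, T w * X j = (coefW F w j)⁻¹ • X (w.right j) * T w) {i k : Fin n} (h : i ≠ k) :
    X i * crossTerm P T i k + crossTerm P T i i * X k =
      X k * crossTerm P T i i + crossTerm P T i k * X i := by
  have hk : k ∈ Finset.univ.erase i := Finset.mem_erase.mpr ⟨h.symm, Finset.mem_univ _⟩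
  rw [crossTerm, crossTerm, if_neg h, if_pos rfl, ← Finset.add_sum_erase _ _ hk]
  have h1 := (commute_diagSum P fun l => commute_zetaW_X hT h.symm l).eq
  have h2 : Commute (∑ j ∈ (Finset.univ.erase i).erase k, reflSum T i j) (X k) :=
    Commute.sum_left _ _ _ fun j hj => commute_reflSum fun l =>
      commute_reflW_X hT h.symm (Finset.ne_of_mem_erase hj).symm l
  simp only [sub_mul, mul_sub, smul_add, add_mul, mul_add, smul_mul_assoc, mul_smul_comm,
    reflSum_mul_X hT h, reflSumZeta_mul_X hT h, h1, h2.eq, Algebra.commutes]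
  abel

/-- This says `[[y_i, x_k], x_l] = [[y_i, x_l], x_k]`, the consistency condition under which the
Dunkl operators are well defined. -/
theorem crossTerm_symm (P : Params r F)
    (hT : ∀ w j, T w * X j = (coefW F w j)⁻¹ • X (w.right j) * T w) (i k l : Fin n) :
    X k * crossTerm P T i l + crossTerm P T i k * X l =
      X l * crossTerm P T i k + crossTerm P T i l * X k := by
  by_cases hkl : k = l
  · subst hkl; rfl
  by_cases hik : i = k
  · subst hik; exact crossTerm_self_X P hT hkl
  by_cases hil : i = l
  · subst hil; exact (crossTerm_self_X P hT hik).symm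
  · have h1 : Commute (crossTerm P T i k) (X l) := by
      rw [crossTerm, if_neg hik]
      exact (commute_reflSumZeta fun m =>
        commute_reflW_X hT (Ne.symm hil) (Ne.symm hkl) m).smul_left _
    have h2 : Commute (crossTerm P T i l) (X k) := by
      rw [crossTerm, if_neg hil]
      exact (commute_reflSumZeta fun m => commute_reflW_X hT (Ne.symm hik) hkl m).smul_left _
    rw [h1.eq, h2.eq, add_comm]

end X

/-! ### Compatibility of the commutators with the operators `y_k`. -/

section Y

variable {Y : Fin n → A} {T : W r n → A}

theorem commute_reflW_Y (hT : ∀ w j, T w * Y j = coefW F w j • Y (w.right j) * T w)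
    {i k m : Fin n} (hi : m ≠ i) (hk : m ≠ k) (l : ℕ) : Commute (T (reflW r i k l)) (Y m) := by
  have := hT (reflW r i k l) m
  rwa [coefW_reflW_of_ne hi hk, one_smul, reflW_right,
    Equiv.swap_apply_of_ne_of_ne hi hk] at this

theorem commute_zetaW_Y (hT : ∀ w j, T w * Y j = coefW F w j • Y (w.right j) * T w)
    {i m : Fin n} (hi : m ≠ i) (l : ℕ) : Commute (T (zetaW r i ^ l)) (Y m) := by
  have := hT (zetaW r i ^ l) m
  rwa [coefW_zetaW_pow_of_ne hi, one_smul, zetaW_pow_right, Equiv.Perm.one_apply] at this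

theorem reflSum_mul_Y (hT : ∀ w j, T w * Y j = coefW F w j • Y (w.right j) * T w)
    {i k : Fin n} (h : i ≠ k) : reflSum T i k * Y k = Y i * reflSumZeta F T k i := by
  rw [reflSum, reflSumZeta_comm, Finset.sum_mul, Finset.mul_sum]
  refine Finset.sum_congr rfl fun l _ => ?_
  rw [hT, coefW_reflW_right h, reflW_right, Equiv.swap_apply_right, smul_mul_assoc,
    mul_smul_comm]

theorem reflSumZeta_mul_Y (hT : ∀ w j, T w * Y j = coefW F w j • Y (w.right j) * T w)
    {i k : Fin n} (h : i ≠ k) : reflSumZeta F T k i * Y i = Y k * reflSum T i k := by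
  rw [reflSum_comm, reflSum, reflSumZeta, Finset.sum_mul, Finset.mul_sum]
  refine Finset.sum_congr rfl fun l _ => ?_
  have h0 : algebraMap ℂ F (zeta r) ^ l ≠ 0 := by
    rw [← rootF_zetaRoot_pow]; exact rootF_ne_zero _
  rw [smul_mul_assoc, hT, coefW_reflW_right h.symm, reflW_right, Equiv.swap_apply_right,
    smul_mul_assoc, smul_smul, inv_mul_cancel₀ h0, one_smul]

theorem crossTerm_self_Y (P : Params r F)
    (hT : ∀ w j, T w * Y j = coefW F w j • Y (w.right j) * T w) {i k : Fin n} (h : i ≠ k) :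
    Y i * crossTerm P T k i - crossTerm P T k i * Y i =
      Y k * crossTerm P T i i - crossTerm P T i i * Y k := by
  have hk : k ∈ Finset.univ.erase i := Finset.mem_erase.mpr ⟨h.symm, Finset.mem_univ _⟩
  rw [crossTerm, crossTerm, if_neg h.symm, if_pos rfl, ← Finset.add_sum_erase _ _ hk]
  have h1 := (commute_diagSum P fun l => commute_zetaW_Y hT h.symm l).eq
  have h2 : Commute (∑ j ∈ (Finset.univ.erase i).erase k, reflSum T i j) (Y k) :=
    Commute.sum_left _ _ _ fun j hj => commute_reflSum fun l =>
      commute_reflW_Y hT h.symm (Finset.ne_of_mem_erase hj).symm l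
  simp only [sub_mul, mul_sub, smul_add, add_mul, mul_add, smul_mul_assoc, mul_smul_comm,
    reflSum_mul_Y hT h, reflSumZeta_mul_Y hT h, h1, h2.eq, Algebra.commutes]
  abel

/-- This says `[y_i, [y_j, x_k]] = [y_j, [y_i, x_k]]`, the Jacobi identity for commuting `y_i`,
`y_j`. Only the equivariance of the `Y i` enters, so it applies to the Dunkl operators before they
are known to commute. -/
theorem crossTerm_jacobi (P : Params r F)
    (hT : ∀ w j, T w * Y j = coefW F w j • Y (w.right j) * T w) (i j k : Fin n) :
    Y i * crossTerm P T j k + crossTerm P T i k * Y j =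
      Y j * crossTerm P T i k + crossTerm P T j k * Y i := by
  rw [← sub_eq_sub_iff_add_eq_add]
  by_cases hij : i = j
  · subst hij; rfl
  by_cases hik : i = k
  · subst hik; exact crossTerm_self_Y P hT hij
  by_cases hjk : j = k
  · subst hjk; exact (crossTerm_self_Y P hT (Ne.symm hij)).symm
  · have h1 : Commute (crossTerm P T j k) (Y i) := by
      rw [crossTerm, if_neg hjk]
      exact (commute_reflSumZeta fun m => commute_reflW_Y hT hij hik m).smul_left _
    have h2 : Commute (crossTerm P T i k) (Y j) := by
      rw [crossTerm, if_neg hik]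
      exact (commute_reflSumZeta fun m => commute_reflW_Y hT (Ne.symm hij) hjk m).smul_left _
    rw [h1.eq, h2.eq, sub_self, sub_self]

end Y

end CrossTerm

/-! ### Relations in the rational Cherednik algebra -/

section Relations

variable {r n : ℕ} [NeZero r] {F : Type} [Field F] [Algebra ℂ F] (P : Params r F)

/-- The quotient map from the free algebra to `ℍ`. -/
def toH : FreeAlgebra F (Gen r n) →ₐ[F] H P n := RingQuot.mkAlgHom F (Rel P n)

theorem toH_surjective : Function.Surjective (toH P (n := n)) :=
  RingQuot.mkAlgHom_surjective F (Rel P n)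

theorem toH_eq {a b : FreeAlgebra F (Gen r n)} (h : Rel P n a b) : toH P a = toH P b :=
  RingQuot.mkAlgHom_rel F h

theorem x_mul_x (i j : Fin n) : x P i * x P j = x P j * x P i := by
  have := toH_eq P (Rel.x_comm i j)
  simp only [map_mul] at this
  exact this

theorem t_one : t P (1 : W r n) = 1 := by
  have := toH_eq P (n := n) Rel.t_one
  rw [map_one] at this
  exact this

theorem t_mul (w w' : W r n) : t P (w * w') = t P w * t P w' := by
  have := toH_eq P (Rel.t_mul w w')
  rw [map_mul] at this
  exact this

theorem t_mul_x (w : W r n) (j : Fin n) :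
    t P w * x P j = (coefW F w j)⁻¹ • x P (w.right j) * t P w := by
  have := toH_eq P (Rel.t_x w j)
  simp only [map_mul, map_smul] at this
  exact this

theorem y_mul_x (i k : Fin n) :
    y P i * x P k = x P k * y P i + crossTerm P (t P) i k := by
  by_cases h : i = k
  · subst h
    have := toH_eq P (Rel.y_x_self i)
    simp only [map_mul, map_add, map_sub, map_sum, map_smul, AlgHom.commutes] at this
    rw [crossTerm, if_pos rfl, ← add_sub_assoc, ← add_sub_assoc]
    exact this
  · have := toH_eq P (Rel.y_x_ne i k h)
    simp only [map_mul, map_add, map_sum, map_smul] at this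
    rw [crossTerm, if_neg h]
    exact this

/-- A property of elements of `ℍ` holds for all of `ℍ` if it holds for scalars and generators and
is closed under sums and products. -/
theorem H.induction {p : H P n → Prop} (scalar : ∀ c : F, p (algebraMap F _ c))
    (gen : ∀ g, p (gen P g)) (mul : ∀ a b, p a → p b → p (a * b))
    (add : ∀ a b, p a → p b → p (a + b)) (h : H P n) : p h := by
  obtain ⟨a, rfl⟩ := toH_surjective P h
  induction a using FreeAlgebra.induction with
  | grade0 c => rw [AlgHom.commutes]; exact scalar c
  | grade1 g => exact gen g
  | mul a b ha hb => rw [map_mul]; exact mul _ _ ha hb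
  | add a b ha hb => rw [map_add]; exact add _ _ ha hb

end Relations

/-! ### The polynomial model of the standard module -/

section Model

variable {r n : ℕ} {F : Type} [Field F] [Algebra ℂ F]

/-- The action of `w` on polynomials. -/
def polyW (F : Type) [Field F] [Algebra ℂ F] (w : W r n) :
    MvPolynomial (Fin n) F →ₐ[F] MvPolynomial (Fin n) F :=
  MvPolynomial.aeval fun j => (coefW F w j)⁻¹ • polyX F (w.right j)

@[simp]
theorem polyW_X (w : W r n) (j : Fin n) :
    polyW F w (polyX F j) = (coefW F w j)⁻¹ • polyX F (w.right j) := by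
  simp [polyW]

theorem polyW_mul (w w' : W r n) : polyW F (w * w') = (polyW F w).comp (polyW F w') := by
  refine MvPolynomial.algHom_ext fun j => ?_
  rw [AlgHom.comp_apply, polyW_X, polyW_X, map_smul, polyW_X, smul_smul, coefW_mul, mul_inv,
    mul_comm]
  rfl

theorem polyW_one : polyW F (1 : W r n) = AlgHom.id F _ := by
  refine MvPolynomial.algHom_ext fun j => ?_
  rw [polyW_X, coefW_one, inv_one, one_smul]
  rfl

theorem tW_mul (w w' : W r n) : tW (w * w') = tW w * tW w' := map_mul _ _ _

theorem tW_one : tW (1 : W r n) = 1 := map_one _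

variable {S : Type*} [AddCommGroup S] [Module ℂ S] [Module (MonoidAlgebra ℂ (W r n)) S]
  [IsScalarTower ℂ (MonoidAlgebra ℂ (W r n)) S]

/-- The action of `w` on `F[x_1, ..., x_n] ⊗ S`. -/
def opW (F : Type) [Field F] [Algebra ℂ F] (S : Type*) [AddCommGroup S] [Module ℂ S]
    [Module (MonoidAlgebra ℂ (W r n)) S] [IsScalarTower ℂ (MonoidAlgebra ℂ (W r n)) S]
    (w : W r n) : Module.End F (PolyTensor F n S) :=
  TensorProduct.AlgebraTensorModule.map (polyW F w).toLinearMap (Algebra.lsmul ℂ ℂ S (tW w))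

@[simp]
theorem opW_tmul (w : W r n) (p : MvPolynomial (Fin n) F) (s : S) :
    opW F S w (p ⊗ₜ s) = polyW F w p ⊗ₜ (tW w • s) := rfl

theorem opW_mul (w w' : W r n) : opW F S (w * w') = opW F S w * opW F S w' := by
  ext p s
  simp [polyW_mul, tW_mul, mul_smul]

theorem opW_one : opW F S (1 : W r n) = 1 := by
  ext p s
  simp [polyW_one, tW_one]

/-- Multiplication by `x_k` on `F[x_1, ..., x_n] ⊗ S`. -/
def opX (F : Type) [Field F] [Algebra ℂ F] (S : Type*) [AddCommGroup S] [Module ℂ S] (k : Fin n) :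
    Module.End F (PolyTensor F n S) :=
  Algebra.lsmul F F _ (polyX F k)

@[simp]
theorem opX_apply (k : Fin n) (g : PolyTensor F n S) : opX F S k g = polyX F k • g := rfl

theorem opX_mul_opX (i j : Fin n) : opX F S i * opX F S j = opX F S j * opX F S i := by
  rw [opX, opX, ← map_mul, mul_comm, map_mul]

theorem opW_mul_opX (w : W r n) (j : Fin n) :
    opW F S w * opX F S j = (coefW F w j)⁻¹ • opX F S (w.right j) * opW F S w := by
  ext p s
  simp [TensorProduct.smul_tmul']

variable [NeZero r] (P : Params r F)

theorem exists_dunkl (S : Type*) [AddCommGroup S] [Module ℂ S]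
    [Module (MonoidAlgebra ℂ (W r n)) S] [IsScalarTower ℂ (MonoidAlgebra ℂ (W r n)) S]
    (i : Fin n) : ∃ D : Module.End F (PolyTensor F n S), (∀ s, D (1 ⊗ₜ s) = 0) ∧
      ∀ k g, D (polyX F k • g) = polyX F k • D g + crossTerm P (opW F S) i k g :=
  exists_twisted_derivation _ fun k l g =>
    LinearMap.congr_fun (crossTerm_symm P (X := opX F S) (T := opW F S) opW_mul_opX i k l) g

/-- The Dunkl operator by which `y_i` acts on `F[x_1, ..., x_n] ⊗ S`. -/
def dunkl (S : Type*) [AddCommGroup S] [Module ℂ S] [Module (MonoidAlgebra ℂ (W r n)) S]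
    [IsScalarTower ℂ (MonoidAlgebra ℂ (W r n)) S] (i : Fin n) : Module.End F (PolyTensor F n S) :=
  (exists_dunkl P S i).choose

@[simp]
theorem dunkl_one_tmul (i : Fin n) (s : S) : dunkl P S i (1 ⊗ₜ s) = 0 :=
  (exists_dunkl P S i).choose_spec.1 s

theorem dunkl_X_smul (i k : Fin n) (g : PolyTensor F n S) :
    dunkl P S i (polyX F k • g) = polyX F k • dunkl P S i g + crossTerm P (opW F S) i k g :=
  (exists_dunkl P S i).choose_spec.2 k g

theorem dunkl_mul_opX (i k : Fin n) :
    dunkl P S i * opX F S k = opX F S k * dunkl P S i + crossTerm P (opW F S) i k :=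
  LinearMap.ext fun g => dunkl_X_smul P i k g

/-- Both sides kill `1 ⊗ S` and satisfy the same commutation rule with `x_k`, by equivariance of
`[y_i, x_k]`. -/
theorem opW_mul_dunkl (w : W r n) (i : Fin n) :
    opW F S w * dunkl P S i = coefW F w i • dunkl P S (w.right i) * opW F S w := by
  refine PolyTensor.hom_ext (fun s => by simp) fun k g hg => ?_
  have h1 : (opW F S w * dunkl P S i) * opX F S k =
      (coefW F w k)⁻¹ • opX F S (w.right k) * (opW F S w * dunkl P S i) +
        (coefW F w i * (coefW F w k)⁻¹) •
          (crossTerm P (opW F S) (w.right i) (w.right k) * opW F S w) := by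
    rw [mul_assoc, dunkl_mul_opX, mul_add, ← mul_assoc, opW_mul_opX, mul_crossTerm opW_mul,
      mul_assoc]
  have h2 : (coefW F w i • dunkl P S (w.right i) * opW F S w) * opX F S k =
      (coefW F w k)⁻¹ • opX F S (w.right k) *
        (coefW F w i • dunkl P S (w.right i) * opW F S w) +
        (coefW F w i * (coefW F w k)⁻¹) •
          (crossTerm P (opW F S) (w.right i) (w.right k) * opW F S w) := by
    rw [mul_assoc, opW_mul_opX]
    simp only [smul_mul_assoc, mul_smul_comm]
    rw [← mul_assoc, dunkl_mul_opX, add_mul, mul_assoc, smul_add, smul_add, smul_smul, smul_smul,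
      smul_smul, mul_comm (coefW F w k)⁻¹]
  refine (LinearMap.congr_fun h1 g).trans (Eq.trans ?_ (LinearMap.congr_fun h2 g).symm)
  rw [LinearMap.add_apply, LinearMap.add_apply, Module.End.mul_apply, hg, ← Module.End.mul_apply]

/-- The commutator of two Dunkl operators kills `1 ⊗ S` and, by `crossTerm_jacobi`, commutes with
every `x_k`. -/
theorem dunkl_comm (i j : Fin n) : dunkl P S i * dunkl P S j = dunkl P S j * dunkl P S i := by
  refine PolyTensor.hom_ext (fun s => by simp) fun k g hg => ?_
  have h := LinearMap.congr_fun
    (crossTerm_jacobi P (Y := dunkl P S) (T := opW F S) (opW_mul_dunkl P) i j k) g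
  simp only [Module.End.mul_apply, LinearMap.add_apply] at h hg ⊢
  simp only [dunkl_X_smul, map_add, hg]
  rw [add_assoc, add_assoc, add_comm (crossTerm P (opW F S) i k _), h,
    add_comm (crossTerm P (opW F S) j k _)]

/-- The action of the rational Cherednik algebra on `F[x_1, ..., x_n] ⊗ S`. -/
def modelHom (S : Type*) [AddCommGroup S] [Module ℂ S] [Module (MonoidAlgebra ℂ (W r n)) S]
    [IsScalarTower ℂ (MonoidAlgebra ℂ (W r n)) S] :
    H P n →ₐ[F] Module.End F (PolyTensor F n S) :=
  RingQuot.liftAlgHom F ⟨FreeAlgebra.lift F fun g =>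
    match g with
    | Gen.x i => opX F S i
    | Gen.y i => dunkl P S i
    | Gen.t w => opW F S w, by
    intro a b h
    induction h with
    | x_comm i j => simpa using opX_mul_opX i j
    | y_comm i j => simpa using dunkl_comm P i j
    | t_one => simpa using opW_one
    | t_mul w w' => simpa using opW_mul w w'
    | t_x w j =>
      simp only [map_mul, map_smul, FreeAlgebra.lift_ι_apply]
      exact opW_mul_opX w j
    | t_y w j =>
      simp only [map_mul, map_smul, FreeAlgebra.lift_ι_apply]
      exact opW_mul_dunkl P w j
    | y_x_ne i j hij =>
      simp only [map_mul, map_add, map_sum, map_smul, FreeAlgebra.lift_ι_apply]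
      rw [dunkl_mul_opX, crossTerm, if_neg hij]
      rfl
    | y_x_self i =>
      simp only [map_mul, map_add, map_sub, map_sum, map_smul, FreeAlgebra.lift_ι_apply,
        AlgHom.commutes]
      rw [dunkl_mul_opX, crossTerm, if_pos rfl, ← add_sub_assoc, ← add_sub_assoc]
      rfl⟩

theorem modelHom_gen (g : Gen r n) : modelHom P S (gen P g) =
    match g with
    | Gen.x i => opX F S i
    | Gen.y i => dunkl P S i
    | Gen.t w => opW F S w := by
  refine (RingQuot.liftAlgHom_mkAlgHom_apply _ _ _ _).trans ?_
  rw [FreeAlgebra.lift_ι_apply]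

@[simp]
theorem modelHom_x (i : Fin n) : modelHom P S (x P i) = opX F S i := modelHom_gen P _

@[simp]
theorem modelHom_y (i : Fin n) : modelHom P S (y P i) = dunkl P S i := modelHom_gen P _

@[simp]
theorem modelHom_t (w : W r n) : modelHom P S (t P w) = opW F S w := modelHom_gen P _

end Model

/-! ### The standard module embeds into its polynomial model -/

section Embedding

variable {r n : ℕ} [NeZero r] {F : Type} [Field F] [Algebra ℂ F] (P : Params r F)
  {lam : RPartition r n}

theorem t_smul_incl (w : W r n) (v : Specht lam) : t P w • incl P v = incl P (tW w • v) := by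
  rw [incl, incl, ← map_smul, ← sub_eq_zero, ← map_sub, TensorProduct.smul_tmul', smul_eq_mul,
    mul_one]
  exact (Submodule.Quotient.mk_eq_zero _).mpr (Submodule.subset_span (Or.inl ⟨w, v, rfl⟩))

theorem y_smul_incl (i : Fin n) (v : Specht lam) : y P i • incl P v = 0 := by
  rw [incl, ← map_smul, TensorProduct.smul_tmul', smul_eq_mul, mul_one]
  exact (Submodule.Quotient.mk_eq_zero _).mpr (Submodule.subset_span (Or.inr ⟨i, v, rfl⟩))

theorem Verma.induction {p : Verma P lam → Prop} (h : ∀ (a : H P n) v, p (a • incl P v))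
    (add : ∀ m m', p m → p m' → p (m + m')) (m : Verma P lam) : p m := by
  obtain ⟨m, rfl⟩ := Submodule.mkQ_surjective _ m
  induction m using TensorProduct.induction_on with
  | zero => rw [map_zero]; simpa using h 0 0
  | add m m' hm hm' => rw [map_add]; exact add _ _ hm hm'
  | tmul a v =>
    have := h a v
    rwa [incl, ← map_smul, TensorProduct.smul_tmul', smul_eq_mul, mul_one] at this

theorem exists_toModel (lam : RPartition r n) :
    ∃ Ψ : Verma P lam →ₗ[F] PolyTensor F n (Specht lam), (∀ v, Ψ (incl P v) = 1 ⊗ₜ v) ∧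
      ∀ a m, Ψ (a • m) = modelHom P (Specht lam) a (Ψ m) := by
  let N := PolyTensor F n (Specht lam)
  let : Module (H P n) N := Module.compHom N (modelHom P (Specht lam)).toRingHom
  have hsmul : ∀ (a : H P n) (g : N), a • g = modelHom P (Specht lam) a g := fun _ _ => rfl
  have : IsScalarTower F (H P n) N :=
    ⟨fun c a g => by rw [hsmul, hsmul, map_smul, LinearMap.smul_apply]⟩
  have : IsScalarTower ℂ (H P n) N := IsScalarTower.of_algebraMap_smul fun c g => by
    rw [IsScalarTower.algebraMap_apply ℂ F (H P n), algebraMap_smul, algebraMap_smul]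
  have : SMulCommClass (H P n) ℂ N := ⟨fun a c g => by
    rw [← algebraMap_smul F c g, hsmul, map_smul, algebraMap_smul, hsmul]⟩
  let u : Specht lam →ₗ[ℂ] N := TensorProduct.mk ℂ (MvPolynomial (Fin n) F) (Specht lam) 1
  let ψ : H P n ⊗[ℂ] Specht lam →ₗ[H P n] N :=
    TensorProduct.AlgebraTensorModule.lift (LinearMap.toSpanSingleton (H P n) _ u)
  have hψ : ∀ a v, ψ (a ⊗ₜ v) = modelHom P (Specht lam) a (1 ⊗ₜ v) := fun _ _ => rfl
  have hker : vermaRelations P lam ≤ LinearMap.ker ψ := by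
    rw [vermaRelations, Submodule.span_le]
    rintro _ (⟨w, v, rfl⟩ | ⟨i, v, rfl⟩)
    · simp [hψ]
    · simp [hψ]
  let Ψ : Verma P lam →ₗ[H P n] N := (vermaRelations P lam).liftQ ψ hker
  refine ⟨Ψ.restrictScalars F, fun v => ?_, fun a m => Ψ.map_smul a m⟩
  change ψ (1 ⊗ₜ v) = _
  simp [hψ]

/-- A linear map from `S` to an `ℍ`-module that is `W`-equivariant and has image killed by the
`y_i` extends to the polynomial model. -/
theorem exists_model_lift {S M : Type*} [AddCommGroup S] [Module ℂ S]
    [Module (MonoidAlgebra ℂ (W r n)) S] [IsScalarTower ℂ (MonoidAlgebra ℂ (W r n)) S]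
    [AddCommGroup M] [Module F M] [Module ℂ M] [IsScalarTower ℂ F M] [Module (H P n) M]
    [IsScalarTower F (H P n) M] (u : S →ₗ[ℂ] M) (hut : ∀ (w : W r n) v, t P w • u v = u (tW w • v))
    (huy : ∀ (i : Fin n) v, y P i • u v = 0) :
    ∃ Γ : PolyTensor F n S →ₗ[F] M, (∀ v, Γ (1 ⊗ₜ v) = u v) ∧
      ∀ a g, Γ (modelHom P S a g) = a • Γ g := by
  let ρ : H P n →ₐ[F] Module.End F M := Algebra.lsmul F F M
  have hρ : ∀ a m, ρ a m = a • m := fun _ _ => rfl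
  obtain ⟨Γ, h1, h2⟩ := exists_polyTensor_lift (fun k => ρ (x P k))
    (fun i j => by rw [← map_mul, x_mul_x, map_mul]) u
  have hx : ∀ k, Γ ∘ₗ opX F S k = ρ (x P k) ∘ₗ Γ := fun k => LinearMap.ext (h2 k)
  -- `Γ` respects the `x_k` by construction. The group elements come next, since the commutators
  -- `[y_i, x_k]`, and hence the induction for the `y_i`, are expressed through them.
  have ht : ∀ w, Γ ∘ₗ opW F S w = ρ (t P w) ∘ₗ Γ := by
    intro w
    refine PolyTensor.hom_ext (fun s => ?_) fun k g hg => ?_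
    · simp only [LinearMap.comp_apply, opW_tmul, map_one, h1, hρ]
      exact (hut w s).symm
    · have e1 := LinearMap.congr_fun (opW_mul_opX (F := F) (S := S) w k) g
      simp only [LinearMap.comp_apply, hρ] at hg ⊢
      simp only [Module.End.mul_apply, opX_apply, LinearMap.smul_apply, smul_mul_assoc] at e1
      rw [e1, map_smul, h2, h2, hg, hρ, hρ, ← mul_smul, ← mul_smul, t_mul_x, smul_mul_assoc,
        smul_assoc]
  have hc : ∀ i k g, Γ (crossTerm P (opW F S) i k g) =
      crossTerm P (t P) i k • Γ g := by
    have hc0 : ∀ w g, Γ (opW F S w g) = t P w • Γ g :=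
      fun w g => LinearMap.congr_fun (ht w) g
    intro i k g
    by_cases h : i = k
    · simp only [crossTerm, if_pos h, diagSum, reflSum, LinearMap.sub_apply,
        LinearMap.smul_apply, LinearMap.sum_apply, map_sub, map_smul, map_sum, hc0, sub_smul,
        Finset.sum_smul, smul_assoc, Module.algebraMap_end_apply, algebraMap_smul]
    · simp only [crossTerm, if_neg h, reflSumZeta, LinearMap.smul_apply, LinearMap.sum_apply,
        map_smul, map_sum, hc0, Finset.sum_smul, smul_assoc]
  have hy : ∀ i, Γ ∘ₗ dunkl P S i = ρ (y P i) ∘ₗ Γ := by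
    intro i
    refine PolyTensor.hom_ext (fun s => ?_) fun k g hg => ?_
    · simp only [LinearMap.comp_apply, dunkl_one_tmul, map_zero, h1, hρ]
      exact (huy i s).symm
    · simp only [LinearMap.comp_apply, hρ] at hg ⊢
      rw [dunkl_X_smul, map_add, h2, h2, hg, hρ, hρ, ← mul_smul, ← mul_smul, y_mul_x, add_smul, hc]
  refine ⟨Γ, h1, fun a => ?_⟩
  induction a using H.induction with
  | scalar c => intro g; rw [AlgHom.commutes, algebraMap_smul, Module.algebraMap_end_apply,
      map_smul]
  | gen g =>
    rw [modelHom_gen]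
    cases g with
    | x k => exact LinearMap.congr_fun (hx k)
    | y i => exact LinearMap.congr_fun (hy i)
    | t w => exact LinearMap.congr_fun (ht w)
  | mul a b ha hb => intro g; rw [map_mul, Module.End.mul_apply, ha, hb, mul_smul]
  | add a b ha hb => intro g; rw [map_add, LinearMap.add_apply, map_add, ha, hb, add_smul]

theorem exists_ofModel (lam : RPartition r n) :
    ∃ Γ : PolyTensor F n (Specht lam) →ₗ[F] Verma P lam, (∀ v, Γ (1 ⊗ₜ v) = incl P v) ∧
      ∀ a g, Γ (modelHom P (Specht lam) a g) = a • Γ g := by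
  let u : Specht lam →ₗ[ℂ] Verma P lam :=
    { toFun := incl P
      map_add' := fun v v' => by simp only [incl, TensorProduct.tmul_add, map_add]
      map_smul' := fun c v => by
        simp only [incl, RingHom.id_apply]
        rw [TensorProduct.tmul_smul, LinearMap.map_smul_of_tower] }
  exact exists_model_lift P u (t_smul_incl P) (y_smul_incl P)

/-- The standard module is isomorphic to `F[x_1, ..., x_n] ⊗ S^lam`. -/
theorem exists_toModel_injective (lam : RPartition r n) :
    ∃ Ψ : Verma P lam →ₗ[F] PolyTensor F n (Specht lam), Function.Injective Ψ ∧
      (∀ v, Ψ (incl P v) = 1 ⊗ₜ v) ∧ ∀ a m, Ψ (a • m) = modelHom P (Specht lam) a (Ψ m) := by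
  obtain ⟨Ψ, h1, h2⟩ := exists_toModel P lam
  obtain ⟨Γ, h3, h4⟩ := exists_ofModel P lam
  -- This one composite suffices: only the injectivity of `Ψ` is used later.
  have h : ∀ m, Γ (Ψ m) = m := by
    intro m
    induction m using Verma.induction with
    | h a v => rw [h2, h1, h4, h3]
    | add m m' hm hm' => rw [map_add, map_add, hm, hm']
  exact ⟨Ψ, Function.LeftInverse.injective h, h1, h2⟩

end Embedding

/-! ### Coordinates in the polynomial model -/

section Coordinates

variable {r n : ℕ} {F : Type} [Field F] [Algebra ℂ F] {ι S : Type*} [AddCommGroup S] [Module ℂ S]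
  (b : Module.Basis ι ℂ S)

/-- The basis of `F[x_1, ..., x_n] ⊗ S` consisting of monomials times basis vectors of `S`. -/
def monoBasis (F : Type) [Field F] [Algebra ℂ F] (n : ℕ) (b : Module.Basis ι ℂ S) :
    Module.Basis ((Fin n →₀ ℕ) × ι) F (PolyTensor F n S) :=
  (MvPolynomial.basisMonomials (Fin n) F).tensorProduct b

/-- The element `x^ν ⊗ s`. -/
def monoTensor (F : Type) [Field F] [Algebra ℂ F] (ν : Fin n →₀ ℕ) (s : S) : PolyTensor F n S :=
  MvPolynomial.monomial ν (1 : F) ⊗ₜ s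

theorem monoBasis_apply (ν : Fin n →₀ ℕ) (j : ι) :
    monoBasis F n b (ν, j) = monoTensor F ν (b j) := by
  simp [monoBasis, monoTensor]

theorem monoBasis_repr_tmul (p : MvPolynomial (Fin n) F) (s : S) (ν : Fin n →₀ ℕ) (j : ι) :
    (monoBasis F n b).repr (p ⊗ₜ s) (ν, j) = b.repr s j • MvPolynomial.coeff ν p := by
  rw [monoBasis, Module.Basis.tensorProduct_repr_tmul_apply]
  rfl

theorem monoBasis_repr_monoTensor_self (ν : Fin n →₀ ℕ) (s : S) (j : ι) :
    (monoBasis F n b).repr (monoTensor F ν s) (ν, j) = algebraMap ℂ F (b.repr s j) := by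
  rw [monoTensor, monoBasis_repr_tmul, MvPolynomial.coeff_monomial, if_pos rfl,
    Algebra.algebraMap_eq_smul_one]

theorem monoBasis_repr_monoTensor_of_ne {ν ν' : Fin n →₀ ℕ} (h : ν ≠ ν') (s : S) (j : ι) :
    (monoBasis F n b).repr (monoTensor F ν s) (ν', j) = 0 := by
  rw [monoTensor, monoBasis_repr_tmul, MvPolynomial.coeff_monomial, if_neg h, smul_zero]

theorem monoBasis_repr_opX_add (k : Fin n) (g : PolyTensor F n S) (ν : Fin n →₀ ℕ) (j : ι) :
    (monoBasis F n b).repr (opX F S k g) (Finsupp.single k 1 + ν, j) =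
      (monoBasis F n b).repr g (ν, j) := by
  induction g using TensorProduct.induction_on with
  | zero => simp
  | add g g' h h' => simp only [map_add, Finsupp.add_apply, h, h']
  | tmul p s =>
    rw [opX_apply, TensorProduct.smul_tmul', monoBasis_repr_tmul, monoBasis_repr_tmul, smul_eq_mul,
      MvPolynomial.coeff_X_mul]

theorem monoBasis_repr_opX_of_eq_zero {k : Fin n} (g : PolyTensor F n S) {ν : Fin n →₀ ℕ}
    (h : ν k = 0) (j : ι) : (monoBasis F n b).repr (opX F S k g) (ν, j) = 0 := by
  induction g using TensorProduct.induction_on with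
  | zero => simp
  | add g g' h h' => simp only [map_add, Finsupp.add_apply, h, h', add_zero]
  | tmul p s =>
    rw [opX_apply, TensorProduct.smul_tmul', monoBasis_repr_tmul, smul_eq_mul,
      MvPolynomial.coeff_X_mul', if_neg (by simpa using h), smul_zero]

theorem opX_injective (F : Type) [Field F] [Algebra ℂ F] (S : Type*) [AddCommGroup S] [Module ℂ S]
    (k : Fin n) : Function.Injective (opX F S k) := by
  rw [injective_iff_map_eq_zero]
  intro g hg
  let b := Module.Basis.ofVectorSpace ℂ S
  refine (monoBasis F n b).ext_elem_iff.mpr fun ⟨ν, j⟩ => ?_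
  rw [← monoBasis_repr_opX_add b k, hg]
  simp

theorem opX_monoTensor (k : Fin n) (ν : Fin n →₀ ℕ) (s : S) :
    opX F S k (monoTensor F ν s) = monoTensor F (Finsupp.single k 1 + ν) s := by
  rw [opX_apply, monoTensor, TensorProduct.smul_tmul', smul_eq_mul, polyX, MvPolynomial.X,
    MvPolynomial.monomial_mul, one_mul, monoTensor]

theorem monoTensor_induction {p : (Fin n →₀ ℕ) → Prop} (zero : p 0)
    (add : ∀ k ν, p ν → p (Finsupp.single k 1 + ν)) (ν : Fin n →₀ ℕ) : p ν := by
  induction ν using Finsupp.induction with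
  | zero => exact zero
  | single_add a c f _ _ ih =>
    clear * - ih add
    induction c with
    | zero => simpa using ih
    | succ c hc => rw [add_comm c 1, Finsupp.single_add, add_assoc]; exact add _ _ hc

theorem monoTensor_zero (s : S) : monoTensor F (0 : Fin n →₀ ℕ) s = 1 ⊗ₜ s := rfl

variable [Module (MonoidAlgebra ℂ (W r n)) S] [IsScalarTower ℂ (MonoidAlgebra ℂ (W r n)) S]

/-- `t_w (x^ν ⊗ s)` is of the form `x^{wν} ⊗ s'`. -/
theorem exists_opW_monoTensor (w : W r n) (ν : Fin n →₀ ℕ) (s : S) :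
    ∃ s', opW F S w (monoTensor F ν s) = monoTensor F (ν.mapDomain w.right) s' := by
  induction ν using monoTensor_induction with
  | zero => exact ⟨tW w • s, by rw [monoTensor_zero, opW_tmul, map_one]; rfl⟩
  | add k ν ih =>
    obtain ⟨s', h⟩ := ih
    refine ⟨(((w.left (w.right k) : ℂˣ) : ℂ))⁻¹ • s', ?_⟩
    rw [← opX_monoTensor, ← Module.End.mul_apply, opW_mul_opX, smul_mul_assoc,
      LinearMap.smul_apply, Module.End.mul_apply, h, opX_monoTensor, Finsupp.mapDomain_add,
      Finsupp.mapDomain_single, monoTensor, monoTensor, TensorProduct.tmul_smul, coefW, rootF,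
      ← map_inv₀, algebraMap_smul]

end Coordinates

/-! ### Vectors with bounded coordinates -/

section Valuation

variable {r n : ℕ} {F : Type} [Field F] [Algebra ℂ F] {ι S : Type*} [AddCommGroup S] [Module ℂ S]
  {Γ₀ : Type*} [LinearOrderedCommGroupWithZero Γ₀] (v : Valuation F Γ₀) (b : Module.Basis ι ℂ S)

/-- The vectors all of whose coordinates have valuation at most `γ`. -/
def bounded (n : ℕ) (γ : Γ₀) : AddSubgroup (PolyTensor F n S) where
  carrier := {g | ∀ e, v ((monoBasis F n b).repr g e) ≤ γ}
  zero_mem' e := by simp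
  add_mem' {g g'} hg hg' e := by
    rw [map_add, Finsupp.add_apply]
    exact (v.map_add _ _).trans (max_le (hg e) (hg' e))
  neg_mem' {g} hg e := by
    rw [map_neg, Finsupp.neg_apply, Valuation.map_neg]
    exact hg e

variable {v b} {γ : Γ₀}

theorem smul_mem_bounded_mul {γ' : Γ₀} {c : F} (hc : v c ≤ γ') {g : PolyTensor F n S}
    (hg : g ∈ bounded v b n γ) : c • g ∈ bounded v b n (γ' * γ) := by
  intro e
  rw [map_smul, Finsupp.smul_apply, smul_eq_mul, map_mul]
  exact mul_le_mul' hc (hg e)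

theorem smul_mem_bounded {c : F} (hc : v c ≤ 1) {g : PolyTensor F n S}
    (hg : g ∈ bounded v b n γ) : c • g ∈ bounded v b n γ := by
  have := smul_mem_bounded_mul hc hg
  rwa [one_mul] at this

variable (v b) in
theorem exists_mem_bounded (g : PolyTensor F n S) : ∃ γ, g ∈ bounded v b n γ := by
  classical
  obtain ⟨γ, h⟩ := Finset.exists_le (((monoBasis F n b).repr g).support.image
    fun e => v ((monoBasis F n b).repr g e))
  refine ⟨γ, fun e => ?_⟩
  by_cases he : (monoBasis F n b).repr g e = 0
  · rw [he, map_zero]; exact zero_le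
  · exact h _ (Finset.mem_image_of_mem _ (Finsupp.mem_support_iff.mpr he))

/-- If an operator sends all `x^ν ⊗ s` to vectors with integral coordinates, then it does not
increase the valuations of coordinates. -/
theorem map_mem_bounded {T : Module.End F (PolyTensor F n S)}
    (hT : ∀ ν s, T (monoTensor F ν s) ∈ bounded v b n 1) {g : PolyTensor F n S}
    (hg : g ∈ bounded v b n γ) : T g ∈ bounded v b n γ := by
  rw [← (monoBasis F n b).linearCombination_repr g, Finsupp.linearCombination_apply, Finsupp.sum,
    map_sum]
  refine sum_mem fun e _ => ?_
  rw [map_smul, monoBasis_apply]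
  have := smul_mem_bounded_mul (hg e) (hT e.1 (b e.2))
  rwa [mul_one] at this

section Integral

variable (hv : ∀ a : ℂ, v (algebraMap ℂ F a) ≤ 1)
include hv

/-- The coordinates of `x^ν ⊗ s` are complex constants, whichever basis of `S` is chosen. -/
theorem monoTensor_mem_bounded (ν : Fin n →₀ ℕ) (s : S) :
    monoTensor F ν s ∈ bounded v b n 1 := by
  rintro ⟨ν', j⟩
  by_cases h : ν = ν'
  · subst h
    rw [monoBasis_repr_monoTensor_self]
    exact hv _
  · rw [monoBasis_repr_monoTensor_of_ne b h, map_zero]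
    exact zero_le

theorem valuation_algebraMap {a : ℂ} (ha : a ≠ 0) : v (algebraMap ℂ F a) = 1 := by
  refine le_antisymm (hv a) ?_
  calc (1 : Γ₀) = v (algebraMap ℂ F a) * v (algebraMap ℂ F a⁻¹) := by
        rw [← map_mul, ← map_mul, mul_inv_cancel₀ ha, map_one, map_one]
    _ ≤ v (algebraMap ℂ F a) * 1 := mul_le_mul_right (hv a⁻¹) _
    _ = _ := mul_one _

theorem opX_mem_bounded (k : Fin n) {g : PolyTensor F n S} (hg : g ∈ bounded v b n γ) :
    opX F S k g ∈ bounded v b n γ :=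
  map_mem_bounded (fun ν s => by rw [opX_monoTensor]; exact monoTensor_mem_bounded hv _ _) hg

/-- `W` acts on `S` over `ℂ` and permutes monomials up to roots of unity, so its matrices have
constant entries. -/
theorem opW_mem_bounded [Module (MonoidAlgebra ℂ (W r n)) S]
    [IsScalarTower ℂ (MonoidAlgebra ℂ (W r n)) S] (w : W r n) {g : PolyTensor F n S}
    (hg : g ∈ bounded v b n γ) : opW F S w g ∈ bounded v b n γ :=
  map_mem_bounded (fun ν s => by
    obtain ⟨s', h⟩ := exists_opW_monoTensor (F := F) w ν s
    rw [h]; exact monoTensor_mem_bounded hv _ _) hg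

end Integral

end Valuation

/-! ### The vanishing argument -/

/-- A valuation with respect to which `κ` is large and the other parameters are integral. -/
structure IsKappaValuation {r : ℕ} [NeZero r] {F : Type} [Field F] [Algebra ℂ F] {Γ₀ : Type*}
    [LinearOrderedCommGroupWithZero Γ₀] (v : Valuation F Γ₀) (P : Params r F) : Prop where
  const_le : ∀ a : ℂ, v (algebraMap ℂ F a) ≤ 1
  c₀_le : v P.c₀ ≤ 1
  d_le : ∀ j, v (P.d j) ≤ 1
  one_lt_κ : 1 < v P.κ

section Vanishing

variable {r n : ℕ} [NeZero r] {F : Type} [Field F] [Algebra ℂ F] {P : Params r F} {ι S : Type*}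
  [AddCommGroup S] [Module ℂ S] [Module (MonoidAlgebra ℂ (W r n)) S]
  [IsScalarTower ℂ (MonoidAlgebra ℂ (W r n)) S]
  {Γ₀ : Type*} [LinearOrderedCommGroupWithZero Γ₀] {v : Valuation F Γ₀} {b : Module.Basis ι ℂ S}

/-! ### Integrality of the group sums, tested by a map `Q` into a group `K` stable under integral
scalars; `Q` will be the identity, a coordinate, or `x_i y_i w`. -/

section Combinations

variable {E : Type*} [AddCommGroup E] [Module F E] {Q : PolyTensor F n S →ₗ[F] E}
  {K : AddSubgroup E} {g : PolyTensor F n S}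

theorem map_reflSum_mem {i k : Fin n} (h : ∀ l, Q (opW F S (reflW r i k l) g) ∈ K) :
    Q (reflSum (r := r) (opW F S) i k g) ∈ K := by
  rw [reflSum, LinearMap.sum_apply, map_sum]
  exact sum_mem fun l _ => h l

theorem map_reflSumZeta_mem (hv : IsKappaValuation v P)
    (hK : ∀ c : F, v c ≤ 1 → ∀ e ∈ K, c • e ∈ K) {i k : Fin n}
    (h : ∀ l, Q (opW F S (reflW r i k l) g) ∈ K) : Q (reflSumZeta (r := r) F (opW F S) i k g) ∈ K := by
  rw [reflSumZeta, LinearMap.sum_apply, map_sum]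
  refine sum_mem fun l _ => ?_
  rw [LinearMap.smul_apply, map_smul, ← map_pow, ← map_inv₀]
  exact hK _ (hv.const_le _) _ (h l)

theorem map_diagSum_mem (hv : IsKappaValuation v P)
    (hK : ∀ c : F, v c ≤ 1 → ∀ e ∈ K, c • e ∈ K) {i : Fin n}
    (h : ∀ l, Q (opW F S (zetaW r i ^ l) g) ∈ K) : Q (diagSum P (opW F S) i g) ∈ K := by
  rw [diagSum, LinearMap.sum_apply, map_sum]
  refine sum_mem fun j _ => ?_
  rw [LinearMap.smul_apply, LinearMap.smul_apply, LinearMap.sum_apply, map_smul, map_smul,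
    map_sum]
  refine hK _ ((v.map_sub _ _).trans (max_le (hv.d_le _) (hv.d_le _))) _ (hK _ ?_ _ ?_)
  · rw [← map_natCast (algebraMap ℂ F), ← map_inv₀]
    exact hv.const_le _
  · refine sum_mem fun l _ => ?_
    rw [LinearMap.smul_apply, map_smul, ← map_pow, ← map_inv₀]
    exact hK _ (hv.const_le _) _ (h l)

end Combinations

theorem bounded_mono {γ γ' : Γ₀} (h : γ ≤ γ') : bounded v b n γ ≤ bounded v b n γ' :=
  fun _ hg e => (hg e).trans h

theorem smul_mem_bounded' {γ : Γ₀} (c : F) (hc : v c ≤ 1) (g : PolyTensor F n S)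
    (hg : g ∈ bounded v b n γ) : c • g ∈ bounded v b n γ := smul_mem_bounded hc hg

/-- Up to operators with integral coefficients, `[y_i, x_k]` is `κ δ_{ik}`. -/
theorem crossTerm_sub_mem_bounded (hv : IsKappaValuation v P) {γ : Γ₀} {g : PolyTensor F n S}
    (hg : g ∈ bounded v b n γ) (i k : Fin n) :
    crossTerm P (opW F S) i k g - (if i = k then P.κ • g else 0) ∈ bounded v b n γ := by
  have hw : ∀ w : W r n, opW F S w g ∈ bounded v b n γ :=
    fun w => opW_mem_bounded hv.const_le w hg
  have h1 : diagSum P (opW F S) i g ∈ bounded v b n γ :=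
    map_diagSum_mem (Q := LinearMap.id) hv smul_mem_bounded' fun l => hw _
  have h2 : ∀ j, reflSum (r := r) (opW F S) i j g ∈ bounded v b n γ := fun j =>
    map_reflSum_mem (Q := LinearMap.id) fun l => hw _
  have h3 : reflSumZeta (r := r) F (opW F S) i k g ∈ bounded v b n γ :=
    map_reflSumZeta_mem (Q := LinearMap.id) hv smul_mem_bounded' fun l => hw _
  by_cases h : i = k
  · have h4 : ∑ j ∈ Finset.univ.erase i, reflSum (r := r) (opW F S) i j g ∈ bounded v b n γ :=
      sum_mem fun j _ => h2 j
    have h5 := neg_mem (add_mem h1 (smul_mem_bounded hv.c₀_le h4))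
    rw [crossTerm, if_pos h, if_pos h]
    simp only [LinearMap.sub_apply, Module.algebraMap_end_apply, LinearMap.smul_apply,
      LinearMap.sum_apply]
    convert h5 using 1
    abel
  · rw [crossTerm, if_neg h, if_neg h, sub_zero, LinearMap.smul_apply]
    exact smul_mem_bounded hv.c₀_le h3

/-- The operator `x_i y_i`. -/
def opXY (P : Params r F) (S : Type*) [AddCommGroup S] [Module ℂ S]
    [Module (MonoidAlgebra ℂ (W r n)) S] [IsScalarTower ℂ (MonoidAlgebra ℂ (W r n)) S]
    (i : Fin n) : Module.End F (PolyTensor F n S) :=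
  opX F S i * dunkl P S i

theorem opXY_mul_opX (i k : Fin n) : opXY P S i * opX F S k =
    opX F S k * opXY P S i + opX F S i * crossTerm P (opW F S) i k := by
  rw [opXY, mul_assoc, dunkl_mul_opX, mul_add, ← mul_assoc, opX_mul_opX, mul_assoc]

theorem opW_mul_opXY (w : W r n) (i : Fin n) :
    opW F S w * opXY P S i = opXY P S (w.right i) * opW F S w := by
  have h := coefW_ne_zero (F := F) w i
  rw [opXY, ← mul_assoc, opW_mul_opX, mul_assoc, opW_mul_dunkl, opXY, smul_mul_assoc,
    smul_mul_assoc, mul_smul_comm, smul_smul, inv_mul_cancel₀ h, one_smul, mul_assoc]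

/-- Build `x^ν` one variable at a time: passing `x_i y_i` through `x_k` adds `x_i [y_i, x_k]`, which
is `κ x_i` for `k = i` and zero otherwise, up to integral operators. -/
theorem opXY_monoTensor_mem_bounded (hv : IsKappaValuation v P) (i : Fin n) (ν : Fin n →₀ ℕ)
    (s : S) : opXY P S i (monoTensor F ν s) - (P.κ * (ν i : F)) • monoTensor F ν s ∈
      bounded v b n 1 := by
  induction ν using monoTensor_induction with
  | zero =>
    have h : opXY P S i (monoTensor F 0 s) = 0 := by
      rw [monoTensor_zero, opXY, Module.End.mul_apply, dunkl_one_tmul, map_zero]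
    rw [h, Finsupp.zero_apply, Nat.cast_zero, mul_zero, zero_smul, sub_zero]
    exact zero_mem _
  | add k ν ih =>
    have h1 := opX_mem_bounded hv.const_le k ih
    have h2 := opX_mem_bounded hv.const_le i
      (crossTerm_sub_mem_bounded hv (monoTensor_mem_bounded (b := b) hv.const_le ν s) i k)
    convert add_mem h1 h2 using 1
    rw [← opX_monoTensor, ← Module.End.mul_apply, opXY_mul_opX, LinearMap.add_apply,
      Module.End.mul_apply, Module.End.mul_apply, map_sub, map_sub, map_smul]
    by_cases h : i = k
    · subst h
      simp only [if_true, map_smul, Finsupp.add_apply, Finsupp.single_eq_same, Nat.cast_add,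
        Nat.cast_one, mul_add, mul_one, add_smul]
      abel
    · simp only [if_neg h, Finsupp.add_apply, Finsupp.single_eq_of_ne h, zero_add, map_zero]
      abel

/-- The operator that multiplies `x^ν ⊗ s` by `ν_i`. -/
def degreeOp (F : Type) [Field F] [Algebra ℂ F] (b : Module.Basis ι ℂ S) (i : Fin n) :
    Module.End F (PolyTensor F n S) :=
  (monoBasis F n b).constr F fun e => (e.1 i : F) • monoBasis F n b e

theorem degreeOp_monoBasis (i : Fin n) (e : (Fin n →₀ ℕ) × ι) :
    degreeOp F b i (monoBasis F n b e) = (e.1 i : F) • monoBasis F n b e :=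
  Module.Basis.constr_basis _ _ _ _

theorem degreeOp_repr (i : Fin n) (g : PolyTensor F n S) (e : (Fin n →₀ ℕ) × ι) :
    (monoBasis F n b).repr (degreeOp F b i g) e = e.1 i * (monoBasis F n b).repr g e := by
  classical
  have h : (monoBasis F n b).coord e ∘ₗ degreeOp F b i = (e.1 i : F) • (monoBasis F n b).coord e := by
    refine (monoBasis F n b).ext fun e' => ?_
    rw [LinearMap.comp_apply, degreeOp_monoBasis, map_smul, LinearMap.smul_apply]
    simp only [Module.Basis.coord_apply, Module.Basis.repr_self, Finsupp.single_apply, smul_eq_mul]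
    split_ifs with h
    · rw [h]
    · simp
  exact LinearMap.congr_fun h g

theorem opXY_sub_mem_bounded (hv : IsKappaValuation v P) (i : Fin n) {γ : Γ₀}
    {g : PolyTensor F n S} (hg : g ∈ bounded v b n γ) :
    opXY P S i g - P.κ • degreeOp F b i g ∈ bounded v b n γ := by
  rw [← (monoBasis F n b).linearCombination_repr g, Finsupp.linearCombination_apply, Finsupp.sum,
    map_sum, map_sum, Finset.smul_sum, ← Finset.sum_sub_distrib]
  refine sum_mem fun e _ => ?_
  have h := smul_mem_bounded_mul (hg e) (opXY_monoTensor_mem_bounded (b := b) hv i e.1 (b e.2))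
  rw [mul_one] at h
  convert h using 1
  rw [map_smul, map_smul, degreeOp_monoBasis, monoBasis_apply, smul_sub, mul_smul, smul_comm P.κ]

/-- On the image of `x_i` the operator `x_i y_i` multiplies valuations by that of `κ`. -/
theorem mem_bounded_of_opXY_mem_bounded (hv : IsKappaValuation v P) {i : Fin n} {γ : Γ₀}
    {g : PolyTensor F n S} (hi : ∀ e : (Fin n →₀ ℕ) × ι, e.1 i = 0 → (monoBasis F n b).repr g e = 0)
    (hg : g ∈ bounded v b n γ) (h : opXY P S i g ∈ bounded v b n γ) :
    g ∈ bounded v b n ((v P.κ)⁻¹ * γ) := by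
  intro e
  by_cases he : e.1 i = 0
  · rw [hi e he, map_zero]
    exact zero_le
  have h1 := sub_mem h (opXY_sub_mem_bounded hv i hg) e
  have hκ : 0 < v P.κ := zero_lt_one.trans hv.one_lt_κ
  -- A nonzero natural number is an invertible complex constant, hence a unit for `v`; dividing by
  -- the degree costs nothing.
  have h2 : v (e.1 i : F) = 1 := by
    rw [← map_natCast (algebraMap ℂ F)]
    exact valuation_algebraMap hv.const_le (Nat.cast_ne_zero.mpr he)
  rw [sub_sub_cancel, map_smul, Finsupp.smul_apply, degreeOp_repr, smul_eq_mul, map_mul, map_mul,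
    h2, one_mul] at h1
  rwa [← mul_le_mul_iff_right₀ hκ, mul_inv_cancel_left₀ hκ.ne']

/-- A family of vectors in the image of `x_i` that is stable under `x_i y_i` up to integral
coefficients vanishes. -/
theorem eq_zero_of_opXY_stable [MulArchimedean Γ₀] (hv : IsKappaValuation v P) {i : Fin n}
    {I : Type*} (h : I → PolyTensor F n S)
    (hi : ∀ w (e : (Fin n →₀ ℕ) × ι), e.1 i = 0 → (monoBasis F n b).repr (h w) e = 0)
    {γ : Γ₀} (h0 : ∀ w, h w ∈ bounded v b n γ)
    (hstep : ∀ γ, (∀ w, h w ∈ bounded v b n γ) → ∀ w, opXY P S i (h w) ∈ bounded v b n γ)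
    (w : I) : h w = 0 := by
  have hκ : 0 < v P.κ := zero_lt_one.trans hv.one_lt_κ
  have hm : ∀ (m : ℕ) w, h w ∈ bounded v b n ((v P.κ)⁻¹ ^ m * γ) := by
    intro m
    induction m with
    | zero => simpa using h0
    | succ m ih =>
      intro w
      rw [pow_succ', mul_assoc]
      exact mem_bounded_of_opXY_mem_bounded hv (hi w) (ih w) (hstep _ ih w)
  refine (monoBasis F n b).ext_elem_iff.mpr fun e => ?_
  rw [map_zero, Finsupp.zero_apply]
  by_contra hne
  have hc : 0 < v ((monoBasis F n b).repr (h w) e) := zero_lt_iff.mpr ((map_ne_zero v).mpr hne)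
  set c := v ((monoBasis F n b).repr (h w) e)
  -- Here `γ ≤ v(κ)^m c`, whereas the bound after `m + 1` contractions reads `v(κ)^(m+1) c ≤ γ`.
  obtain ⟨m, hm'⟩ := MulArchimedean.arch (γ * c⁻¹) hv.one_lt_κ
  have h1 : c ≤ (v P.κ)⁻¹ ^ (m + 1) * γ := hm (m + 1) w e
  have h2 : v P.κ ^ (m + 1) * c ≤ γ := by
    rw [← mul_le_mul_iff_right₀ (pow_pos hκ (m + 1)), ← mul_assoc _ _ γ, ← mul_pow,
      mul_inv_cancel₀ hκ.ne', one_pow, one_mul] at h1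
    exact h1
  have h3 : γ ≤ v P.κ ^ m * c := by
    rw [← mul_le_mul_iff_left₀ hc, mul_assoc, inv_mul_cancel₀ hc.ne', mul_one] at hm'
    exact hm'
  have h4 := h2.trans h3
  rw [mul_le_mul_iff_left₀ hc] at h4
  exact absurd h4 (not_le.mpr (pow_lt_pow_right₀ hv.one_lt_κ (Nat.lt_succ_self m)))

/-- The right-hand side of `hf` involves only integral scalars and group elements preserving the
indices `≥ i`. Translating `f` by all such elements gives a family to which `eq_zero_of_opXY_stable`
applies. -/
theorem dunkl_eq_zero [MulArchimedean Γ₀] (hv : IsKappaValuation v P) {i : Fin n}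
    {f : PolyTensor F n S} (c : Fin n → F) (hc : ∀ j, i ≤ j → v (c j) ≤ 1)
    (hf : ∀ j, i ≤ j → opXY P S j f = c j • f + diagSum P (opW F S) j f +
      P.c₀ • ∑ k ∈ Finset.univ.filter (fun k : Fin n => j < k), reflSum (r := r) (opW F S) j k f) :
    dunkl P S i f = 0 := by
  let b := Module.Basis.ofVectorSpace ℂ S
  let I := {w : W r n // ∀ j, i ≤ w.right j ↔ i ≤ j}
  let h : I → PolyTensor F n S := fun w => opXY P S i (opW F S w.1 f)
  obtain ⟨γ, hγ⟩ := exists_mem_bounded v b f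
  have hi : ∀ w (e : (Fin n →₀ ℕ) × _), e.1 i = 0 → (monoBasis F n b).repr (h w) e = 0 :=
    fun w e he => monoBasis_repr_opX_of_eq_zero b _ he _
  have hκ : γ ≤ v P.κ * γ := le_mul_of_one_le_left' hv.one_lt_κ.le
  -- The initial bound: `x_i y_i` enlarges valuations at most by `v κ`, because the degree operator
  -- has integral entries.
  have h0 : ∀ w, h w ∈ bounded v b n (v P.κ * γ) := by
    intro w
    have h1 := opW_mem_bounded hv.const_le w.1 hγ
    have h2 := opXY_sub_mem_bounded hv i h1
    have h3 : degreeOp F b i (opW F S w.1 f) ∈ bounded v b n γ := by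
      refine map_mem_bounded (fun ν s => ?_) h1
      intro e
      rw [degreeOp_repr, map_mul, ← map_natCast (algebraMap ℂ F)]
      exact mul_le_one' (hv.const_le _) (monoTensor_mem_bounded hv.const_le ν s e)
    have h4 := smul_mem_bounded_mul (le_refl (v P.κ)) h3
    have h5 := add_mem (bounded_mono hκ h2) h4
    rwa [sub_add_cancel] at h5
  have key := eq_zero_of_opXY_stable hv h hi h0 ?_ ⟨1, fun j => Iff.rfl⟩
  · have h1 : opX F S i (dunkl P S i f) = 0 := by
      simpa [h, opW_one, opXY] using key
    exact opX_injective F S i (h1.trans (map_zero _).symm)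
  intro γ hγ w
  -- Equivariance turns `h w` into `w x_j y_j f` with `j ≥ i`, so that `hf` can be substituted under
  -- `x_i y_i w`.
  let j := w.1.right.symm i
  have hj : i ≤ j := (w.2 j).mp (by simp [j])
  -- The vector `x_i y_i w u f` is again a member of the family, namely `h (w u)`.
  have hw : ∀ u : W r n, (∀ m, i ≤ u.right m ↔ i ≤ m) →
      (opXY P S i * opW F S w.1) (opW F S u f) ∈ bounded v b n γ := by
    intro u hu
    rw [Module.End.mul_apply, ← Module.End.mul_apply (opW F S w.1), ← opW_mul]
    exact hγ ⟨w.1 * u, fun m => (w.2 _).trans (hu m)⟩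
  have h1 : h w = opW F S w.1 (opXY P S j f) := by
    have := LinearMap.congr_fun (opW_mul_opXY (P := P) (S := S) w.1 j) f
    rw [Equiv.apply_symm_apply] at this
    exact this.symm
  have h2 : opXY P S i (h w) = (opXY P S i * opW F S w.1) (opXY P S j f) := by
    rw [h1, Module.End.mul_apply]
  rw [h2, hf j hj, map_add, map_add, map_smul, map_smul, map_sum]
  refine add_mem (add_mem ?_ ?_) (smul_mem_bounded hv.c₀_le (sum_mem fun k hk => ?_))
  · exact smul_mem_bounded (hc j hj) (hγ w)
  · exact map_diagSum_mem hv smul_mem_bounded' fun l => hw _ fun m => by simp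
  · refine map_reflSum_mem fun l => hw _ fun m => ?_
    have hk : j < k := (Finset.mem_filter.mp hk).2
    rw [reflW_right, Equiv.swap_apply_def]
    split_ifs with h3 h4
    · rw [h3]; exact ⟨fun _ => hj, fun _ => hj.trans hk.le⟩
    · rw [h4]; exact ⟨fun _ => hj.trans hk.le, fun _ => hj⟩
    · rfl

end Vanishing

/-! ### Leading coefficients and eigenvalues -/

section Eigenvalues

variable {r n : ℕ} [NeZero r] {F : Type} [Field F] [Algebra ℂ F] {P : Params r F} {ι S : Type*}
  [AddCommGroup S] [Module ℂ S] [Module (MonoidAlgebra ℂ (W r n)) S]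
  [IsScalarTower ℂ (MonoidAlgebra ℂ (W r n)) S]

theorem modelHom_reflSum (i k : Fin n) :
    modelHom P S (reflSum (t P) i k) = reflSum (r := r) (opW F S) i k := by
  simp [reflSum]

theorem z_eq_reflSum (j : Fin n) : z P j =
    y P j * x P j + P.c₀ • ∑ k ∈ Finset.univ.filter (fun k : Fin n => k < j), reflSum (t P) j k :=
  rfl

/-- Writing `y_j x_j` as `x_j y_j` plus the commutator, the reflections with `k < j` cancel against
`c_0 φ_j`. Only `k > j` survive, which keeps the indices `≥ i` closed. -/
theorem modelHom_z (j : Fin n) : modelHom P S (z P j) =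
    opXY P S j + algebraMap F _ P.κ - diagSum P (opW F S) j -
      P.c₀ • ∑ k ∈ Finset.univ.filter (fun k : Fin n => j < k), reflSum (r := r) (opW F S) j k := by
  have h : Finset.univ.erase j = Finset.univ.filter (fun k : Fin n => j < k) ∪
      Finset.univ.filter (fun k : Fin n => k < j) := by
    ext k
    simp only [Finset.mem_erase, Finset.mem_univ, Finset.mem_union, Finset.mem_filter, true_and,
      and_true]
    exact ne_comm.trans lt_or_lt_iff_ne.symm
  have hd : Disjoint (Finset.univ.filter (fun k : Fin n => j < k))
      (Finset.univ.filter (fun k : Fin n => k < j)) :=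
    Finset.disjoint_filter.mpr fun k _ h1 h2 => absurd h1 (not_lt.mpr h2.le)
  rw [z_eq_reflSum, map_add, map_mul, map_smul, map_sum, modelHom_y, modelHom_x, dunkl_mul_opX,
    crossTerm, if_pos rfl, h, Finset.sum_union hd, smul_add]
  simp only [modelHom_reflSum, opXY]
  abel

theorem modelHom_xPow (μ : Fin n → ℕ) (s : S) :
    modelHom P S (xPow P μ) (1 ⊗ₜ s) = monoTensor F (Finsupp.equivFunOnFinite.symm μ) s := by
  have h : modelHom P S (xPow P μ) =
      Algebra.lsmul F F _ (List.ofFn fun i => polyX F i ^ μ i).prod := by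
    rw [xPow, map_list_prod, map_list_prod, List.map_ofFn, List.map_ofFn]
    congr 2
    funext i
    simp [opX]
  rw [h, List.prod_ofFn, Algebra.lsmul_coe]
  beta_reduce
  rw [TensorProduct.smul_tmul', smul_eq_mul, mul_one,
    monoTensor, MvPolynomial.monomial_eq, Finsupp.prod_fintype _ _ (by simp)]
  simp

/-- The span of all `x^ν ⊗ s` with `ν ≠ μ`. -/
def offSpan (F : Type) [Field F] [Algebra ℂ F] (S : Type*) [AddCommGroup S] [Module ℂ S]
    (μ : Fin n →₀ ℕ) : Submodule F (PolyTensor F n S) :=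
  Submodule.span F {g | ∃ ν s, ν ≠ μ ∧ g = monoTensor F ν s}

-- An element fixing the exponent `μ` permutes the other exponents among themselves, so lower terms
-- never reach `x^μ`.
omit [NeZero r] in
theorem repr_opW_of_mem_offSpan (b : Module.Basis ι ℂ S) {μ : Fin n →₀ ℕ} {w : W r n}
    (hw : μ.mapDomain w.right = μ) {g : PolyTensor F n S} (hg : g ∈ offSpan F S μ) (e : ι) :
    (monoBasis F n b).repr (opW F S w g) (μ, e) = 0 := by
  induction hg using Submodule.span_induction with
  | mem g hg =>
    obtain ⟨ν, s, hν, rfl⟩ := hg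
    obtain ⟨s', h⟩ := exists_opW_monoTensor (F := F) w ν s
    rw [h]
    refine monoBasis_repr_monoTensor_of_ne b (fun h => hν ?_) s' e
    exact Finsupp.mapDomain_injective w.right.injective (h.trans hw.symm)
  | zero => simp
  | add g g' _ _ h h' => simp only [map_add, Finsupp.add_apply, h, h', add_zero]
  | smul c g _ h => simp only [map_smul, Finsupp.smul_apply, h, smul_zero]

omit [NeZero r] in
theorem repr_opW_leading (b : Module.Basis ι ℂ S) {μ : Fin n →₀ ℕ} {s : S} {w : W r n}
    (hw : μ.mapDomain w.right = μ) {f : PolyTensor F n S}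
    (hf : f - monoTensor F μ s ∈ offSpan F S μ) (e : ι) :
    ∃ a : ℂ, (monoBasis F n b).repr (opW F S w f) (μ, e) = algebraMap ℂ F a := by
  have h := repr_opW_of_mem_offSpan b hw hf e
  obtain ⟨s', h'⟩ := exists_opW_monoTensor (F := F) w μ s
  rw [map_sub, map_sub, Finsupp.sub_apply, sub_eq_zero, h', hw,
    monoBasis_repr_monoTensor_self] at h
  exact ⟨_, h⟩

variable {Γ₀ : Type*} [LinearOrderedCommGroupWithZero Γ₀] {v : Valuation F Γ₀}

/-- Compare the coefficients of `x^μ` in the eigenvalue equation. The term `x_j y_j f` contributes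
nothing as `μ_j = 0`, and the group elements in `z_j` fix `μ`, so they contribute integral scalars
times constants. The coordinate of `s` is a nonzero constant and can be divided out. -/
theorem eigenvalue_sub_kappa_le (hv : IsKappaValuation v P) {μ : Fin n →₀ ℕ} {s : S} (hs : s ≠ 0)
    {f : PolyTensor F n S} (hf : f - monoTensor F μ s ∈ offSpan F S μ) {j : Fin n}
    (hj : ∀ k, j ≤ k → μ k = 0) {α : F} (hα : modelHom P S (z P j) f = α • f) :
    v (α - P.κ) ≤ 1 := by
  let b := Module.Basis.ofVectorSpace ℂ S
  obtain ⟨e, he⟩ : ∃ e, b.repr s e ≠ 0 := by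
    by_contra h
    push Not at h
    exact hs (b.ext_elem_iff.mpr fun e => by rw [h e]; simp)
  let Q : PolyTensor F n S →ₗ[F] F := (monoBasis F n b).coord (μ, e)
  let K : AddSubgroup F := v.integer.toAddSubgroup
  have hKmem : ∀ c, c ∈ K ↔ v c ≤ 1 := fun _ => Iff.rfl
  have hK : ∀ c : F, v c ≤ 1 → ∀ a ∈ K, c • a ∈ K := fun c hc a ha => by
    rw [hKmem, smul_eq_mul, map_mul]
    exact mul_le_one' hc ha
  have hQ : ∀ w : W r n, μ.mapDomain w.right = μ → Q (opW F S w f) ∈ K := fun w hw => by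
    obtain ⟨a, ha⟩ := repr_opW_leading b hw hf e
    exact (congrArg v ha).trans_le (hv.const_le a)
  have hQf : Q f = algebraMap ℂ F (b.repr s e) := by
    have h := repr_opW_of_mem_offSpan b (w := (1 : W r n)) (Finsupp.mapDomain_id) hf e
    rw [opW_one, Module.End.one_apply, map_sub, Finsupp.sub_apply, sub_eq_zero,
      monoBasis_repr_monoTensor_self] at h
    exact h
  have h0 : Q (opXY P S j f) = 0 :=
    monoBasis_repr_opX_of_eq_zero b _ (hj j le_rfl) e
  have h1 : Q (diagSum P (opW F S) j f) ∈ K := map_diagSum_mem hv hK fun l => hQ _ <| by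
    rw [zetaW_pow_right]; exact Finsupp.mapDomain_id
  have h2 : ∀ k, j < k → Q (reflSum (r := r) (opW F S) j k f) ∈ K := fun k hk =>
    map_reflSum_mem fun l => hQ _ <| by
      ext m
      rw [reflW_right]
      obtain ⟨m, rfl⟩ := (Equiv.swap j k).surjective m
      rw [Finsupp.mapDomain_apply (Equiv.swap j k).injective, Equiv.swap_apply_def]
      split_ifs with h3 h4
      · rw [h3, hj j le_rfl, hj k hk.le]
      · rw [h4, hj j le_rfl, hj k hk.le]
      · rfl
  have h3 := congrArg Q hα
  rw [modelHom_z] at h3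
  simp only [LinearMap.sub_apply, LinearMap.add_apply, Module.algebraMap_end_apply,
    LinearMap.smul_apply, LinearMap.sum_apply, map_sub, map_add, map_smul, map_sum, h0,
    zero_add] at h3
  have h4 : (α - P.κ) • Q f ∈ K := by
    rw [sub_smul, ← h3, sub_sub (P.κ • Q f), sub_sub_cancel_left]
    exact neg_mem (add_mem h1 (hK _ hv.c₀_le _ (sum_mem fun k hk =>
      h2 k (Finset.mem_filter.mp hk).2)))
  rwa [hKmem, hQf, smul_eq_mul, map_mul, valuation_algebraMap hv.const_le he, mul_one] at h4

theorem dunkl_eq_zero_of_eigenvector [MulArchimedean Γ₀] (hv : IsKappaValuation v P)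
    {μ : Fin n →₀ ℕ} {s : S} (hs : s ≠ 0) {f : PolyTensor F n S}
    (hf : f - monoTensor F μ s ∈ offSpan F S μ) {i : Fin n} (hi : ∀ k, i ≤ k → μ k = 0)
    {α : Fin n → F} (hα : ∀ j, modelHom P S (z P j) f = α j • f) : dunkl P S i f = 0 := by
  refine dunkl_eq_zero hv (fun j => α j - P.κ) (fun j hj =>
    eigenvalue_sub_kappa_le hv hs hf (fun k hk => hi k (hj.trans hk)) (hα j)) fun j _ => ?_
  have h := hα j
  rw [modelHom_z] at h
  simp only [LinearMap.sub_apply, LinearMap.add_apply, Module.algebraMap_end_apply,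
    LinearMap.smul_apply, LinearMap.sum_apply] at h
  have e := congrArg (· • f) (sub_add_cancel (α j) P.κ)
  simp only [add_smul] at e
  rw [← e, sub_sub, sub_eq_iff_eq_add, add_right_comm] at h
  rw [add_right_cancel h, add_assoc]

end Eigenvalues

/-! ### The order on compositions is irreflexive -/

section Order

variable {n : ℕ}

theorem BruhatLT.len_lt {u w : Equiv.Perm (Fin n)} (h : BruhatLT u w) : len u < len w := by
  induction h with
  | single h => obtain ⟨_, _, _, _, h⟩ := h; exact h
  | tail _ h ih => obtain ⟨_, _, _, _, h⟩ := h; exact ih.trans h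

/-- Each Bruhat step raises the length, so the order is irreflexive; this separates the lower terms
from `x^μ`. -/
theorem CompLT.ne {μ ν : Fin n → ℕ} (h : CompLT μ ν) : μ ≠ ν := by
  rintro rfl
  rcases h with h | ⟨_, h⟩
  · exact h.1 rfl
  · exact lt_irrefl _ h.len_lt

end Order

/-! ### The vectors `v_T` do not vanish unless `S^lam` does -/

section Tableaux

variable {r n : ℕ} {lam : RPartition r n}

/-- The number of inversions of the permutation `S⁻¹ T`. -/
def tabInv (T S : SYT lam) : ℕ := len (T.1.trans S.1.symm)

theorem box_ext {c c' : Box lam} (hb : beta c = beta c') (hr : row c = row c')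
    (hc : col c = col c') : c = c' := by
  obtain ⟨k, ⟨a, b⟩, h⟩ := c
  obtain ⟨k', ⟨a', b'⟩, h'⟩ := c'
  simp only [beta, row, col] at hb hr hc
  subst hb hr hc
  rfl

/-- The box in the row of `c` and the column of `c'` lies in the diagram if `c'` lies in the same
component and weakly below `c`. -/
theorem exists_corner {c c' : Box lam} (hb : beta c = beta c') (hr : row c ≤ row c') :
    ∃ d : Box lam, beta d = beta c' ∧ row d = row c ∧ col d = col c' := by
  obtain ⟨k, ⟨a, b⟩, h⟩ := c
  obtain ⟨k', ⟨a', b'⟩, h'⟩ := c'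
  simp only [beta, row] at hb hr
  subst hb
  have h'' : (a, b') ∈ (lam.part k).cells := by
    rw [YoungDiagram.mem_cells] at h' ⊢
    exact (lam.part k).up_left_mem hr le_rfl h'
  exact ⟨⟨k, (a, b'), h''⟩, rfl, rfl, rfl⟩

/-- The entries of a standard tableau increase weakly to the south-east. -/
theorem SYT.le_of_row_le_col_le (T : SYT lam) {c c' : Box lam} (hb : beta c = beta c')
    (hr : row c ≤ row c') (hc : col c ≤ col c') : T.1.symm c ≤ T.1.symm c' := by
  obtain ⟨d, h1, h2, h3⟩ := exists_corner hb hr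
  have hle1 : T.1.symm c ≤ T.1.symm d := by
    rcases hc.eq_or_lt with h | h
    · rw [box_ext (hb.trans h1.symm) h2.symm (h.trans h3.symm)]
    · exact (T.2.1 _ _ (hb.trans h1.symm) h2.symm (h.trans_eq h3.symm)).le
  have hle2 : T.1.symm d ≤ T.1.symm c' := by
    rcases hr.eq_or_lt with h | h
    · rw [box_ext h1 (h2.trans h) h3]
    · exact (T.2.2 _ _ h1 h3 (h2.trans_lt h)).le
  exact hle1.trans hle2

/-- Consecutive entries of a standard tableau in boxes of adjacent content are in adjacent boxes,
so that they cannot be exchanged. -/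
theorem not_isStandard_swap {T : SYT lam} {i j : Fin n} (hij : (j : ℕ) = i + 1)
    (hb : beta (T.1 i) = beta (T.1 j)) (hct : |ct (T.1 j) - ct (T.1 i)| = 1) :
    ¬ IsStandard ((Equiv.swap i j).trans T.1) := by
  intro hS
  have hlt : i < j := Fin.lt_def.mpr (by omega)
  have hi : ((Equiv.swap i j).trans T.1).symm (T.1 i) = j := by simp
  have hj : ((Equiv.swap i j).trans T.1).symm (T.1 j) = i := by simp
  have hrow : ¬ (row (T.1 i) = row (T.1 j) ∧ col (T.1 i) < col (T.1 j)) := fun h => by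
    have := hS.1 _ _ hb h.1 h.2
    rw [hi, hj] at this
    exact absurd this (not_lt.mpr hlt.le)
  have hcol : ¬ (col (T.1 i) = col (T.1 j) ∧ row (T.1 i) < row (T.1 j)) := fun h => by
    have := hS.2 _ _ hb h.1 h.2
    rw [hi, hj] at this
    exact absurd this (not_lt.mpr hlt.le)
  have hse : ¬ (row (T.1 j) ≤ row (T.1 i) ∧ col (T.1 j) ≤ col (T.1 i)) := fun h => by
    have := T.le_of_row_le_col_le hb.symm h.1 h.2
    simp only [Equiv.symm_apply_apply] at this
    exact absurd this (not_le.mpr hlt)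
  have hstrict : ¬ (row (T.1 i) < row (T.1 j) ∧ col (T.1 i) < col (T.1 j)) := fun h => by
    obtain ⟨d, h1, h2, h3⟩ := exists_corner hb h.1.le
    have h4 : T.1.symm (T.1 i) < T.1.symm d :=
      T.2.1 _ _ (hb.trans h1.symm) h2.symm (h.2.trans_eq h3.symm)
    have h5 : T.1.symm d < T.1.symm (T.1 j) := T.2.2 _ _ h1 h3 (h2.trans_lt h.1)
    rw [Equiv.symm_apply_apply, Fin.lt_def] at h4 h5
    omega
  -- The four exclusions leave `j` strictly north-east or strictly south-west of `i`, where the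
  -- contents differ by at least `2`.
  simp only [ct] at hct
  rcases abs_eq (zero_le_one' ℤ) |>.mp hct with h | h <;> omega

/-- If `S` contains the entries `i` and `i + 1` of `T` in reverse order, then exchanging them in
`T` gives a standard tableau. -/
theorem isStandard_swap {T S : SYT lam} {i j : Fin n} (hij : (j : ℕ) = i + 1)
    (h : S.1.symm (T.1 j) < S.1.symm (T.1 i)) : IsStandard ((Equiv.swap i j).trans T.1) := by
  have key : ∀ b b' : Box lam, T.1.symm b < T.1.symm b' → S.1.symm b < S.1.symm b' →
      ((Equiv.swap i j).trans T.1).symm b < ((Equiv.swap i j).trans T.1).symm b' := by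
    intro b b' h1 h2
    obtain ⟨p, rfl⟩ := T.1.surjective b
    obtain ⟨q, rfl⟩ := T.1.surjective b'
    simp only [Equiv.symm_apply_apply, Equiv.symm_trans_apply, Equiv.symm_swap] at h1 ⊢
    have hne : ¬ (p = i ∧ q = j) := by
      rintro ⟨rfl, rfl⟩
      exact absurd h (not_lt.mpr h2.le)
    rw [Equiv.swap_apply_def, Equiv.swap_apply_def]
    simp only [Fin.lt_def, Fin.ext_iff] at *
    split_ifs <;> omega
  exact ⟨fun b b' hb hr hc => key b b' (T.2.1 b b' hb hr hc) (S.2.1 b b' hb hr hc),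
    fun b b' hb hc hr => key b b' (T.2.2 b b' hb hc hr) (S.2.2 b b' hb hc hr)⟩

/-- A permutation other than the identity has a descent. -/
theorem exists_descent {w : Equiv.Perm (Fin n)} (hw : w ≠ 1) :
    ∃ i j : Fin n, (j : ℕ) = i + 1 ∧ w j < w i := by
  by_contra h
  push Not at h
  refine hw ?_
  have hmono : StrictMono w := by
    cases n with
    | zero => exact fun i => i.elim0
    | succ n =>
      refine Fin.strictMono_iff_lt_succ.mpr fun i => ?_
      exact lt_of_le_of_ne (h _ _ (by simp)) (w.injective.ne (Fin.castSucc_lt_succ).ne)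
  exact Equiv.ext fun i => congrFun ((hmono.range_inj strictMono_id).mp (by simp [w.surjective.range_eq])) i

/-- Applying the adjacent transposition to both positions injects the inversions of `w * Equiv.swap
i j` into those of `w` other than `(i, j)`. -/
theorem len_swap_mul_lt {w : Equiv.Perm (Fin n)} {i j : Fin n} (hij : (j : ℕ) = i + 1)
    (h : w j < w i) : len (w * Equiv.swap i j) < len w := by
  have hlt : i < j := Fin.lt_def.mpr (by omega)
  have hmem : (i, j) ∈ Finset.univ.filter fun p : Fin n × Fin n => p.1 < p.2 ∧ w p.2 < w p.1 :=
    Finset.mem_filter.mpr ⟨Finset.mem_univ _, hlt, h⟩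
  refine lt_of_le_of_lt ?_ (Finset.card_erase_lt_of_mem hmem)
  refine Finset.card_le_card_of_injOn (fun p => (Equiv.swap i j p.1, Equiv.swap i j p.2)) ?_ ?_
  · rintro ⟨p, q⟩ hpq
    replace hpq := (Finset.mem_filter.mp (Finset.mem_coe.mp hpq)).2
    simp only [Equiv.Perm.mul_apply] at hpq
    have hne : ¬ (p = i ∧ q = j) := by
      rintro ⟨rfl, rfl⟩
      rw [Equiv.swap_apply_left, Equiv.swap_apply_right] at hpq
      exact absurd h (not_lt.mpr hpq.2.le)
    have hs : Equiv.swap i j p < Equiv.swap i j q ∧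
        ¬ (Equiv.swap i j p = i ∧ Equiv.swap i j q = j) := by
      have hpq' := hpq.1
      rw [Equiv.swap_apply_def, Equiv.swap_apply_def]
      simp only [Fin.lt_def, Fin.ext_iff] at hpq' hne hij ⊢
      split_ifs <;> omega
    refine Finset.mem_coe.mpr (Finset.mem_erase.mpr ⟨fun h' => hs.2 (Prod.ext_iff.mp h'), ?_⟩)
    exact Finset.mem_filter.mpr ⟨Finset.mem_univ _, hs.1, hpq.2⟩
  · rintro ⟨p, q⟩ _ ⟨p', q'⟩ _ h'
    simpa using h'

/-- A descent of `S⁻¹ T` is a pair of consecutive entries in the wrong order relative to `S`;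
exchanging them stays standard and moves `T` closer to `S`. -/
theorem exists_swap_of_ne {T S : SYT lam} (h : T ≠ S) :
    ∃ i j : Fin n, (j : ℕ) = i + 1 ∧ ∃ hst : IsStandard ((Equiv.swap i j).trans T.1),
      tabInv ⟨_, hst⟩ S < tabInv T S := by
  have hne : (T.1.trans S.1.symm : Equiv.Perm (Fin n)) ≠ 1 := by
    intro h1
    refine h (Subtype.ext (Equiv.ext fun i => ?_))
    have := Equiv.congr_fun h1 i
    simpa [Equiv.symm_apply_eq] using this
  obtain ⟨i, j, hij, hlt⟩ := exists_descent hne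
  have e : ((Equiv.swap i j).trans T.1).trans S.1.symm =
      (T.1.trans S.1.symm : Equiv.Perm (Fin n)) * Equiv.swap i j := Equiv.ext fun _ => rfl
  exact ⟨i, j, hij, isStandard_swap hij hlt, (congrArg len e).trans_lt (len_swap_mul_lt hij hlt)⟩

variable [NeZero r]

theorem tauRHS_vT (T : SYT lam) {i j : Fin n} (hij : (j : ℕ) = i + 1) :
    tW (permW r (Equiv.swap i j)) • vT T +
      (1 / ((r : ℂ) * (ct (T.1 i) : ℂ) - (r : ℂ) * (ct (T.1 j) : ℂ))) •
        piW (r := r) i j • vT T = tauRHS vT T i j := by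
  have h := (Submodule.Quotient.eq (spechtRelations lam)).mpr
    (Submodule.subset_span ⟨_, _, SpechtRel.tau T i j hij, rfl⟩)
  refine Eq.trans ?_ (h.trans ?_)
  · rfl
  · rw [tauRHS, tauRHS]
    split_ifs <;> rfl

/-- The coefficient in the formula for `τ_i v_T` is nonzero: it could vanish only for adjacent
contents in one component, and then the exchange would not be standard. -/
theorem vT_swap_eq_zero {T : SYT lam} (h : vT T = 0) {i j : Fin n} (hij : (j : ℕ) = i + 1)
    (hst : IsStandard ((Equiv.swap i j).trans T.1)) :
    vT (⟨(Equiv.swap i j).trans T.1, hst⟩ : SYT lam) = 0 := by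
  have h1 := tauRHS_vT T hij
  rw [h, smul_zero, smul_zero, smul_zero, add_zero, tauRHS, dif_pos hst] at h1
  refine (smul_eq_zero.mp h1.symm).resolve_left ?_
  split_ifs with hb
  · rw [Complex.ofReal_eq_zero]
    refine (Real.sqrt_pos.mpr ?_).ne'
    rw [sub_pos, sq_lt_one_iff_abs_lt_one, abs_div, abs_one]
    have h2 : |ct (T.1 j) - ct (T.1 i)| ≠ 1 := fun h2 => not_isStandard_swap hij hb h2 hst
    -- Equal contents need not be ruled out: with `1 / 0 = 0` the coefficient is then `1`.
    rcases eq_or_ne (ct (T.1 j) - ct (T.1 i)) 0 with h3 | h3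
    · have h4 : (ct (T.1 j) : ℝ) - ct (T.1 i) = 0 := by exact_mod_cast h3
      rw [h4, abs_zero, div_zero]
      exact one_pos
    · have h4 : (2 : ℤ) ≤ |ct (T.1 j) - ct (T.1 i)| := by
        have := abs_pos.mpr h3
        omega
      have h5 : (2 : ℝ) ≤ |(ct (T.1 j) : ℝ) - ct (T.1 i)| := by exact_mod_cast h4
      rw [div_lt_one (by linarith)]
      linarith
  · exact one_ne_zero

theorem vT_eq_zero_of_vT_eq_zero {T : SYT lam} (h : vT T = 0) (S : SYT lam) : vT S = 0 := by
  induction hm : tabInv T S using Nat.strong_induction_on generalizing T with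
  | _ m ih =>
    by_cases hTS : T = S
    · rw [← hTS, h]
    obtain ⟨i, j, hij, hst, hlt⟩ := exists_swap_of_ne hTS
    exact ih _ (hm ▸ hlt) (vT_swap_eq_zero h hij hst) rfl

theorem specht_eq_zero {T : SYT lam} (h : vT T = 0) (s : Specht lam) : s = 0 := by
  obtain ⟨s, rfl⟩ := Submodule.mkQ_surjective _ s
  induction s using Finsupp.induction_linear with
  | zero => rw [map_zero]
  | add s s' hs hs' => rw [map_add, hs, hs', add_zero]
  | single S a =>
    have h1 : (Finsupp.single S a : SYT lam →₀ MonoidAlgebra ℂ (W r n)) = a • freeV S := by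
      rw [freeV, Finsupp.smul_single, smul_eq_mul, mul_one]
    rw [h1, map_smul]
    exact (congrArg (a • ·) (vT_eq_zero_of_vT_eq_zero h S)).trans (smul_zero a)

end Tableaux

/-! ### The degree in `κ` -/

section KappaDegree

variable (r : ℕ)

/-- The polynomials in the parameters as polynomials in `κ`. -/
def kappaPoly : MvPolynomial (ParamVar r) ℂ →ₐ[ℂ] Polynomial (ParamField r) :=
  MvPolynomial.aeval fun p =>
    match p with
    | ParamVar.κ => Polynomial.X
    | q => Polynomial.C (pvar q)

/-- Substituting the element `κ` of the field for the polynomial variable recovers the inclusion of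
polynomials into their fraction field. -/
theorem kappaPoly_injective : Function.Injective (kappaPoly r) := by
  have h : ((Polynomial.aeval (pvar ParamVar.κ : ParamField r)).restrictScalars ℂ).comp (kappaPoly r) =
      IsScalarTower.toAlgHom ℂ (MvPolynomial (ParamVar r) ℂ) (ParamField r) := by
    refine MvPolynomial.algHom_ext fun p => ?_
    cases p <;> simp [kappaPoly, pvar]
  have h' : Function.Injective
      (((Polynomial.aeval (pvar ParamVar.κ : ParamField r)).restrictScalars ℂ).comp (kappaPoly r)) := by
    rw [h]
    exact IsFractionRing.injective _ _
  exact Function.Injective.of_comp h'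

/-- The embedding of the field of parameters into the rational functions in `κ`. -/
def kappaRatFunc : ParamField r →+* RatFunc (ParamField r) :=
  IsFractionRing.lift (A := MvPolynomial (ParamVar r) ℂ)
    (g := (algebraMap (Polynomial (ParamField r)) (RatFunc (ParamField r))).comp
      (kappaPoly r).toRingHom)
    ((RatFunc.algebraMap_injective _).comp (kappaPoly_injective r))

theorem kappaRatFunc_algebraMap (p : MvPolynomial (ParamVar r) ℂ) :
    kappaRatFunc r (algebraMap _ _ p) = algebraMap _ _ (kappaPoly r p) :=
  IsFractionRing.lift_algebraMap _ _

open Classical in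
/-- The valuation given by the degree in `κ`. -/
def kappaValuation : Valuation (ParamField r) (WithZero (Multiplicative ℤ)) :=
  (RatFunc.inftyValuation (ParamField r)).comap (kappaRatFunc r)

/-- The valuation at infinity of a nonzero constant in `κ` is `1`; this covers every parameter other
than `κ`. -/
theorem kappaValuation_le_one {p : MvPolynomial (ParamVar r) ℂ} {c : ParamField r}
    (h : kappaPoly r p = Polynomial.C c) :
    kappaValuation r (algebraMap _ _ p) ≤ 1 := by
  classical
  rw [kappaValuation, Valuation.comap_apply, kappaRatFunc_algebraMap, h, RatFunc.algebraMap_C]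
  by_cases hc : c = 0
  · simp [hc]
  · exact (RatFunc.inftyValuation.C _ hc).le

theorem isKappaValuation [NeZero r] : IsKappaValuation (kappaValuation r) (generic r) where
  const_le a := by
    rw [IsScalarTower.algebraMap_apply ℂ (MvPolynomial (ParamVar r) ℂ) (ParamField r)]
    refine kappaValuation_le_one r (c := algebraMap _ _ a) ?_
    rw [AlgHom.commutes]
    rfl
  c₀_le := kappaValuation_le_one r (c := pvar ParamVar.c₀) (by simp [kappaPoly])
  d_le j := by
    have h : ∀ j hj, kappaValuation r (pvar (ParamVar.d j hj)) ≤ 1 := fun j hj =>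
      kappaValuation_le_one r (c := pvar (ParamVar.d j hj)) (by simp [kappaPoly])
    rw [generic]
    dsimp only
    split_ifs with hj
    · rw [Valuation.map_neg]
      exact Valuation.map_sum_le _ fun k _ => h _ _
    · exact h _ _
  one_lt_κ := by
    classical
    have h : kappaPoly r (MvPolynomial.X ParamVar.κ) = Polynomial.X := by simp [kappaPoly]
    change 1 < kappaValuation r (algebraMap _ _ _)
    rw [kappaValuation, Valuation.comap_apply, kappaRatFunc_algebraMap, h, RatFunc.algebraMap_X,
      RatFunc.inftyValuation.X]
    decide

end KappaDegree

/-! ### The main theorem -/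

theorem y_smul_eq_zero (r n : ℕ) [NeZero r] (lam : RPartition r n) (μ : Fin n → ℕ) (T : SYT lam)
    (f : Verma (generic r) lam) (hf : IsJack (generic r) μ T f) (i : Fin n)
    (hi : ∀ j : Fin n, i ≤ j → μ j = 0) : y (generic r) i • f = 0 := by
  obtain ⟨⟨hne, heig⟩, hlead⟩ := hf
  obtain ⟨Ψ, hinj, hincl, hΨ⟩ := exists_toModel_injective (generic r) lam
  have hα : ∀ j, ∃ a : ParamField r, z (generic r) j • f = a • f := fun j =>
    heig _ (Algebra.subset_adjoin (Or.inl ⟨j, rfl⟩))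
  choose α hα using hα
  have hxv : ∀ ν (S : SYT lam), Ψ (xv (generic r) ν S) =
      monoTensor _ (Finsupp.equivFunOnFinite.symm ν) (tW (permW r (wMu ν)⁻¹) • vT S) := by
    intro ν S
    rw [xv, hΨ, hincl, modelHom_xPow]
  have hs : tW (permW r (wMu μ)⁻¹) • vT T ≠ 0 := by
    intro h
    have h1 : tW (permW r (wMu μ)) • tW (permW r (wMu μ)⁻¹) • vT T = vT T := by
      rw [← mul_smul, ← tW_mul, permW, permW, ← map_mul, mul_inv_cancel, map_one, tW_one, one_smul]
    rw [h, smul_zero] at h1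
    -- A vanishing leading vector forces `S^lam = 0`, hence a zero standard module, against `f ≠ 0`.
    have h2 : ∀ m : Verma (generic r) lam, m = 0 := by
      intro m
      induction m using Verma.induction with
      | h a v => rw [specht_eq_zero h1.symm v, incl, TensorProduct.tmul_zero, map_zero, smul_zero]
      | add m m' hm hm' => rw [hm, hm', add_zero]
    exact hne (h2 f)
  have hlead' : Ψ f - monoTensor _ (Finsupp.equivFunOnFinite.symm μ)
      (tW (permW r (wMu μ)⁻¹) • vT T) ∈
      offSpan (ParamField r) (Specht lam) (Finsupp.equivFunOnFinite.symm μ) := by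
    rw [← hxv, ← map_sub]
    generalize f - xv (generic r) μ T = g at hlead
    induction hlead using Submodule.span_induction with
    | mem m hm =>
      obtain ⟨ν, S, hν, rfl⟩ := hm
      rw [hxv]
      exact Submodule.subset_span ⟨_, _, fun h =>
        hν.ne (Finsupp.equivFunOnFinite.symm.injective h), rfl⟩
    | zero => rw [map_zero]; exact zero_mem _
    | add m m' _ _ h h' => rw [map_add]; exact add_mem h h'
    | smul c m _ h => rw [map_smul]; exact Submodule.smul_mem _ _ h
  refine hinj ?_
  rw [hΨ, map_zero, modelHom_y]
  exact dunkl_eq_zero_of_eigenvector (isKappaValuation r) hs hlead' hi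
    fun j => by rw [← hΨ, hα, map_smul]

end Cherednik

end

theorem mainTheorem10 (r n : ℕ) [NeZero r] (lam : Cherednik.RPartition r n)
    (μ : Fin n → ℕ) (T : Cherednik.SYT lam)
    (f : Cherednik.Verma (Cherednik.generic r) lam)
    (hf : Cherednik.IsJack (Cherednik.generic r) μ T f)
    (i : Fin n) (hi : ∀ j : Fin n, i ≤ j → μ j = 0) :
    Cherednik.y (Cherednik.generic r) i • f = 0 :=
  Cherednik.y_smul_eq_zero r n lam μ T f hf i hi
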